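/- For $n\ge 2$ let $\mathbb D_n=\{\pm e_i\pm e_j : 1\le i<j\le n\}\subset\mathbb R^n$ be the root system of type $D_n$, with the conventions that $\mathbb D_0=\emptyset\subset\mathbb R^0$ and $\mathbb D_1=\{\pm e_1\}\subset\mathbb R^1$ (i.e. $\mathbb D_1=\mathbb A_1$; note $\mathbb D_2\cong\mathbb A_1\times\mathbb A_1$ and $\mathbb D_3\cong\mathbb A_3$). Fix a base of $\mathbb D_n$ for each $n$, and let $\mathbb D_n^+$ be the corresponding set of positive roots. A subset $\Phi\subseteq\mathbb D_n^+$ is an inversion set if both $\Phi$ and $\mathbb D_n^+\setminus\Phi$ are closed under those sums of two of their elements that are again roots. A fine decomposition of $\mathbb D_n$ is an (unordered) partition of $\mathbb D_n^+$ into exactly $n$ (the rank) nonempty pairwise disjoint inversion sets. Let $d_n$ be the number of fine decompositions of $\mathbb D_n$, and let $a_k=\frac{1}{k+1}\binom{2k}{k}$ be the $k$-th Catalan number. Then for all $n\ge 3$ $$d_n=d_{n-1}+2\sum_{i=0}^{n-2}a_{i+1}\,d_{n-i-2}+2a_{n-1}-6a_{n-2},$$ and $d_0=1$, while $d_1,\dots,d_6$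 are $1,1,5,19,69,249$. -/

import Mathlib

/-- `S` is a base of the set of roots `R` in the real vector space `V`: it consists of roots, it is a
basis of `V`, and every root or its negative is a combination of elements of `S` with natural number
coefficients. -/
def IsRootBase {V : Type*} [AddCommGroup V] [Module ℝ V] (R S : Set V) : Prop :=
  S ⊆ R ∧ LinearIndepOn ℝ id S ∧ Submodule.span ℝ S = ⊤ ∧
    ∀ α ∈ R, α ∈ AddSubmonoid.closure S ∨ -α ∈ AddSubmonoid.closure S

/-- The roots that are positive with respect to `S`: those that are combinations of elements of `S`
with natural number coefficients. -/
def posRoots {V : Type*} [AddCommGroup V] (R S : Set V) : Set V :=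
  {α | α ∈ R ∧ α ∈ AddSubmonoid.closure S}

/-- An inversion set in a set `P` of positive roots is a subset that is closed and co-closed
(a sum is considered only when it is again a root in `P`). -/
def IsInversionSet {V : Type*} [AddCommGroup V] (P Φ : Set V) : Prop :=
  Φ ⊆ P ∧
  (∀ α ∈ Φ, ∀ β ∈ Φ, α + β ∈ P → α + β ∈ Φ) ∧
  (∀ α ∈ P \ Φ, ∀ β ∈ P \ Φ, α + β ∈ P → α + β ∈ P \ Φ)

/-- A decomposition of `Φ` inside `P`: an unordered family `D` of nonempty, pairwise disjoint
inversion sets in `P` whose union is `Φ`. -/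
def IsDecomposition {V : Type*} [AddCommGroup V] (P Φ : Set V) (D : Set (Set V)) : Prop :=
  (∀ Ψ ∈ D, Ψ.Nonempty ∧ IsInversionSet P Ψ) ∧
  (∀ Ψ ∈ D, ∀ Ψ' ∈ D, Ψ ≠ Ψ' → Disjoint Ψ Ψ') ∧
  ⋃₀ D = Φ

/-- A fine decomposition of the root system `R` with base `S`: a decomposition of the set of all
positive roots into exactly as many parts as the rank, the dimension of the ambient space. -/
def IsFineDecomposition {V : Type*} [AddCommGroup V] [Module ℝ V] (R S : Set V)
    (D : Set (Set V)) : Prop :=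
  IsDecomposition (posRoots R S) (posRoots R S) D ∧ D.encard = (Module.finrank ℝ V : ℕ∞)

/-- The number of fine decompositions of the root system `R` with base `S`. -/
noncomputable def numFineDecompositions {V : Type*} [AddCommGroup V] [Module ℝ V]
    (R S : Set V) : ℕ :=
  {D : Set (Set V) | IsFineDecomposition R S D}.ncard

/-- The `i`-th standard basis vector of `ℝⁿ`. -/
noncomputable def stdVec {n : ℕ} (i : Fin n) : Fin n → ℝ := Pi.single i 1

/-- The root system of type `D_n` in `ℝⁿ`: all vectors `±e_i ± e_j` with `i ≠ j`. The second part
only matters for `n = 1`, where it realizes the convention `D_1 = A_1`. For `n = 0` there are no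
roots, for `n = 2` this is `A_1 × A_1`, and for `n = 3` it is (isomorphic to) `A_3`. -/
def rootsD (n : ℕ) : Set (Fin n → ℝ) :=
  {v | ∃ i j : Fin n, i ≠ j ∧ (v = stdVec i + stdVec j ∨ v = stdVec i - stdVec j ∨
      v = -(stdVec i + stdVec j))} ∪
  {v | n = 1 ∧ ∃ i : Fin n, v = stdVec i ∨ v = -stdVec i}

/-- The standard simple roots of `D_n`: `e_i - e_{i+1}`, and `e_{n-1} + e_n` as the last one
(`e_1` alone if `n = 1`). -/
noncomputable def simpleRootD (n : ℕ) (i : Fin n) : Fin n → ℝ :=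
  if h : (i : ℕ) + 1 < n then stdVec i - stdVec ⟨i + 1, h⟩
  else if 0 < (i : ℕ) then stdVec ⟨i - 1, by omega⟩ + stdVec i
  else stdVec i

theorem sub_mem_closure_simpleRootD (n : ℕ) (i : Fin n) (k : ℕ) (h : (i : ℕ) + k < n) :
    stdVec i - stdVec ⟨i + k, h⟩ ∈ AddSubmonoid.closure (Set.range (simpleRootD n)) := by
  induction k with
  | zero => simp
  | succ k ih =>
    have h1 := ih (by omega)
    have h2 : stdVec (⟨i + k, by omega⟩ : Fin n) - stdVec ⟨i + (k + 1), h⟩ ∈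
        AddSubmonoid.closure (Set.range (simpleRootD n)) := by
      apply AddSubmonoid.subset_closure
      refine ⟨⟨i + k, by omega⟩, ?_⟩
      have h3 : (i : ℕ) + k + 1 < n := by omega
      simp only [simpleRootD, h3, dif_pos]
      rfl
    have := add_mem h1 h2
    rwa [sub_add_sub_cancel] at this

theorem sub_mem_closure_simpleRootD' (n : ℕ) (i j : Fin n) (h : i ≤ j) :
    stdVec i - stdVec j ∈ AddSubmonoid.closure (Set.range (simpleRootD n)) := by
  have h' : (i : ℕ) ≤ j := h
  have := sub_mem_closure_simpleRootD n i (j - i) (by omega)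
  convert this using 3
  ext
  simp only
  omega

theorem add_mem_closure_simpleRootD (n : ℕ) (i j : Fin n) (h : i < j) :
    stdVec i + stdVec j ∈ AddSubmonoid.closure (Set.range (simpleRootD n)) := by
  have h' : (i : ℕ) < j := h
  have hj := j.isLt
  have h1 := sub_mem_closure_simpleRootD' n i ⟨n - 2, by omega⟩ (by
    change (i : ℕ) ≤ n - 2; omega)
  have h2 := sub_mem_closure_simpleRootD' n j ⟨n - 1, by omega⟩ (by
    change (j : ℕ) ≤ n - 1; omega)
  have h3 : stdVec (⟨n - 2, by omega⟩ : Fin n) + stdVec ⟨n - 1, by omega⟩ ∈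
      AddSubmonoid.closure (Set.range (simpleRootD n)) := by
    apply AddSubmonoid.subset_closure
    refine ⟨⟨n - 1, by omega⟩, ?_⟩
    have h4 : ¬ (n - 1 + 1 < n) := by omega
    have h5 : 0 < n - 1 := by omega
    simp only [simpleRootD, h4, h5, dif_neg, if_pos, not_false_eq_true]
    congr 1
  have := add_mem (add_mem h1 h2) h3
  convert this using 1
  abel

/-- The standard simple roots form a base, so that bases of `D_n` exist for every `n`. -/
theorem isRootBase_simpleRootD (n : ℕ) :
    IsRootBase (rootsD n) (Set.range (simpleRootD n)) := by
  have hcl : ∀ v ∈ AddSubmonoid.closure (Set.range (simpleRootD n)),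
      v ∈ Submodule.span ℝ (Set.range (simpleRootD n)) := fun v hv => by
    have : AddSubmonoid.closure (Set.range (simpleRootD n)) ≤
        (Submodule.span ℝ (Set.range (simpleRootD n))).toAddSubmonoid :=
      AddSubmonoid.closure_le.2 Submodule.subset_span
    exact this hv
  have hone : ∀ i : Fin n, n = 1 →
      stdVec i ∈ AddSubmonoid.closure (Set.range (simpleRootD n)) := by
    intro i hn
    have hi := i.isLt
    apply AddSubmonoid.subset_closure
    refine ⟨i, ?_⟩
    have h1 : ¬ ((i : ℕ) + 1 < n) := by omega
    have h2 : ¬ (0 < (i : ℕ)) := by omega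
    simp only [simpleRootD, h1, h2, dif_neg, if_neg, not_false_eq_true]
  have hspan : Submodule.span ℝ (Set.range (simpleRootD n)) = ⊤ := by
    have hvec : ∀ i : Fin n, stdVec i ∈ Submodule.span ℝ (Set.range (simpleRootD n)) := by
      intro i
      by_cases hn : n = 1
      · exact hcl _ (hone i hn)
      · have key : ∀ a b : Fin n, a < b →
            stdVec a ∈ Submodule.span ℝ (Set.range (simpleRootD n)) ∧
            stdVec b ∈ Submodule.span ℝ (Set.range (simpleRootD n)) := by
          intro a b hab
          have h1 := hcl _ (add_mem_closure_simpleRootD n a b hab)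
          have h2 := hcl _ (sub_mem_closure_simpleRootD' n a b hab.le)
          constructor
          · have := Submodule.smul_mem _ (1 / 2 : ℝ) (add_mem h1 h2)
            convert this using 1
            module
          · have := Submodule.smul_mem _ (1 / 2 : ℝ) (sub_mem h1 h2)
            convert this using 1
            module
        have hi := i.isLt
        by_cases h0 : (i : ℕ) = 0
        · exact (key i ⟨1, by omega⟩ (by change (i : ℕ) < 1; omega)).1
        · exact (key ⟨0, by omega⟩ i (by change 0 < (i : ℕ); omega)).2
    rw [eq_top_iff, ← (Pi.basisFun ℝ (Fin n)).span_eq, Submodule.span_le]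
    rintro _ ⟨i, rfl⟩
    simpa [stdVec] using hvec i
  refine ⟨?_, ?_, hspan, ?_⟩
  · rintro _ ⟨i, rfl⟩
    have hi := i.isLt
    unfold simpleRootD
    split_ifs with h h0
    · refine Or.inl ⟨i, ⟨i + 1, h⟩, ?_, Or.inr (Or.inl rfl)⟩
      intro hc
      have := congrArg Fin.val hc
      simp at this
    · refine Or.inl ⟨⟨i - 1, by omega⟩, i, ?_, Or.inl rfl⟩
      intro hc
      have := congrArg Fin.val hc
      simp only at this
      omega
    · exact Or.inr ⟨by omega, i, Or.inl rfl⟩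
  · have : LinearIndependent ℝ (simpleRootD n) :=
      linearIndependent_of_top_le_span_of_card_eq_finrank hspan.ge (by simp)
    exact this.linearIndepOn_id
  · rintro v (⟨i, j, hij, rfl | rfl | rfl⟩ | ⟨hn, i, rfl | rfl⟩)
    · left
      rcases lt_or_gt_of_ne hij with h | h
      · exact add_mem_closure_simpleRootD n i j h
      · rw [add_comm]
        exact add_mem_closure_simpleRootD n j i h
    · rcases lt_or_gt_of_ne hij with h | h
      · exact Or.inl (sub_mem_closure_simpleRootD' n i j h.le)
      · right
        rw [neg_sub]
        exact sub_mem_closure_simpleRootD' n j i h.le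
    · right
      rw [neg_neg]
      rcases lt_or_gt_of_ne hij with h | h
      · exact add_mem_closure_simpleRootD n i j h
      · rw [add_comm]
        exact add_mem_closure_simpleRootD n j i h
    · exact Or.inl (hone i hn)
    · right
      rw [neg_neg]
      exact hone i hn

/-! A set of positive roots whose complement is closed and which misses every simple root is empty.
So every part of a decomposition contains a simple root, and in a fine decomposition each part
contains exactly one. A fine decomposition is therefore the same as a colouring of the positive
roots by the simple roots, where each simple root has its own colour and a sum takes the colour of
one of its summands (`ncard_decompositions`). Any base of D_n is, up to a signed permutation of
coordinates, the standard one (`exists_frame`), so it remains to count pairs `(m, p)`: the colours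
of e_i - e_j and of e_i + e_j.

In type A the colour s of the longest root forces the colour s on every root across s and leaves the
two sides independent. This is the Catalan recurrence (`ncard_aCol`).

In type D, on indices [a, n), compare the colours u of e_a - e_{n-1} and v of e_a + e_{n-1}.

If u = v, there is a proper initial block [a, t) such that the colouring consists of a type A
colouring of the block, a type D colouring of [t, n), and forced colours elsewhere
(`IsDCol.isGlued_of_eq`). There are two ways of forcing: a root leaving the block at i is coloured s
if i ≤ s and t - 1 otherwise, where s is either t - 1 or the colour of e_a - e_{t-1}. The second way
needs a block of at least two indices. This gives d_{n-1} and the sum with coefficient 2.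

If u ≠ v, then v = n - 1 or u = n - 2, and the diagram automorphism exchanges these two cases.
Colourings with v = n - 1 are glued with t = n (`IsDCol.isGlued_of_last`), so they are counted by
Catalan numbers. Inclusion-exclusion gives 4 (a_{n-1} - a_{n-2}). Adding the terms of the sum that
belong to d_1 = d_0 = 1 turns this into the stated correction 2 a_{n-1} - 6 a_{n-2}. -/

/-! ### Colourings of positive roots in types A and D -/

/-- Colourings of the positive roots `e_i - e_j` (`a ≤ i < j < b`) by the simple roots, where
`e_i - e_{i+1}` has colour `i`, such that the colour of a sum is the colour of a summand. -/
structure IsACol (a b : ℕ) (m : ℕ → ℕ → ℕ) : Prop where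
  supp : ∀ i j, ¬ (a ≤ i ∧ i < j ∧ j < b) → m i j = 0
  simple : ∀ i, a ≤ i → i + 1 < b → m i (i + 1) = i
  law : ∀ i j k, a ≤ i → i < j → j < k → k < b → m i k = m i j ∨ m i k = m j k

/-- Colourings of the positive roots `e_i - e_j` (colour `m i j`) and `e_i + e_j` (colour `p i j`)
with indices in `[a, n)`; the last simple root `e_{n-2} + e_{n-1}` has colour `n - 1`. -/
structure IsDCol (a n : ℕ) (m p : ℕ → ℕ → ℕ) : Prop where
  isACol : IsACol a n m
  supp : ∀ i j, ¬ (a ≤ i ∧ a ≤ j ∧ i ≠ j ∧ i < n ∧ j < n) → p i j = 0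
  symm : ∀ i j, p i j = p j i
  simple : a + 2 ≤ n → p (n - 2) (n - 1) = n - 1
  law : ∀ i j k, a ≤ i → a ≤ k → i < j → k ≠ i → k ≠ j → j < n → k < n →
    p i k = m i j ∨ p i k = p j k

def aCol (a b : ℕ) : Set (ℕ → ℕ → ℕ) := {m | IsACol a b m}

def dCol (a n : ℕ) : Set ((ℕ → ℕ → ℕ) × (ℕ → ℕ → ℕ)) := {c | IsDCol a n c.1 c.2}

/-- By induction on the length, the colour of a root is a simple root in its support. Colours are
absolute indices, so this excludes one alternative of `law` in most later arguments. -/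
theorem IsACol.bounds {a b : ℕ} {m : ℕ → ℕ → ℕ} (h : IsACol a b m) {i j : ℕ} (hi : a ≤ i)
    (hij : i < j) (hj : j < b) : i ≤ m i j ∧ m i j < j := by
  induction j, hij using Nat.le_induction with
  | base => rw [h.simple i hi hj]; omega
  | succ k hk ih =>
    have h1 := ih (by omega)
    have h2 := h.simple k (by omega) hj
    rcases h.law i k (k + 1) hi hk (by omega) hj with h3 | h3 <;> omega

/-- The colour of the longest root determines the colours of all roots supported on it. -/
theorem IsACol.eq_of_le_of_lt {a b : ℕ} {m : ℕ → ℕ → ℕ} (h : IsACol a b m) {l i j : ℕ}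
    (hl : l < b) (hi : a ≤ i) (his : i ≤ m a l) (hsj : m a l < j) (hj : j ≤ l) :
    m i j = m a l := by
  have h1 : m a j = m a l := by
    rcases hj.eq_or_lt with rfl | hjl
    · rfl
    · have := h.bounds (i := j) (j := l) (by omega) hjl hl
      rcases h.law a j l le_rfl (by omega) hjl hl with h3 | h3 <;> omega
  rcases hi.eq_or_lt with rfl | hai
  · exact h1
  · have := h.bounds (i := a) (j := i) le_rfl hai (by omega)
    rcases h.law a i j le_rfl hai (by omega) (by omega) with h3 | h3 <;> omega

theorem finite_setOf_bounded (b : ℕ) :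
    {f : ℕ → ℕ → ℕ | ∀ i j, ¬ (i < b ∧ j < b ∧ f i j < b) → f i j = 0}.Finite := by
  -- Reduction mod b only serves to land in `Fin b`; it loses nothing because the values in range
  -- are already below b.
  refine Set.Finite.of_finite_image (f := fun f (i j : Fin b) =>
    (⟨f i j % b, Nat.mod_lt _ (by have := i.2; omega)⟩ : Fin b)) (Set.toFinite _) ?_
  intro f hf g hg hfg
  funext i j
  by_cases hij : i < b ∧ j < b
  · have h1 := congrFun (congrFun hfg ⟨i, hij.1⟩) ⟨j, hij.2⟩
    simp only [Fin.mk.injEq] at h1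
    have h2 : f i j < b := by
      by_contra hc
      have := hf i j (by tauto)
      omega
    have h3 : g i j < b := by
      by_contra hc
      have := hg i j (by tauto)
      omega
    rwa [Nat.mod_eq_of_lt h2, Nat.mod_eq_of_lt h3] at h1
  · rw [hf i j (by tauto), hg i j (by tauto)]

theorem finite_aCol (a b : ℕ) : (aCol a b).Finite := by
  refine (finite_setOf_bounded b).subset ?_
  intro m hm i j hij
  by_contra hc
  have h1 : a ≤ i ∧ i < j ∧ j < b := by
    by_contra h2
    exact hc (hm.supp i j h2)
  have := IsACol.bounds hm h1.1 h1.2.1 h1.2.2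
  omega

/-- Writing e_i + e_{n-1} = (e_i - e_{n-2}) + (e_{n-2} + e_{n-1}) shows that e_{n-2} - e_{n-1} is
not in its support, so the colour n - 2 cannot occur. -/
theorem IsDCol.plus_last_cases {a n : ℕ} {m p : ℕ → ℕ → ℕ} (h : IsDCol a n m p) {i : ℕ}
    (hi : a ≤ i) (hin : i + 1 < n) : p i (n - 1) < n - 2 ∨ p i (n - 1) = n - 1 := by
  have h1 := h.simple (by omega)
  by_cases h2 : i = n - 2
  · subst h2
    exact Or.inr h1
  · have := h.isACol.bounds (i := i) (j := n - 2) hi (by omega) (by omega)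
    rcases h.law i (n - 2) (n - 1) hi (by omega) (by omega) (by omega) (by omega) (by omega)
      (by omega) with h3 | h3 <;> omega

theorem IsDCol.plus_lt {a n : ℕ} {m p : ℕ → ℕ → ℕ} (h : IsDCol a n m p) {i j : ℕ}
    (hi : a ≤ i) (hj : a ≤ j) (hij : i ≠ j) (hin : i < n) (hjn : j < n) : p i j < n := by
  wlog hlt : i < j generalizing i j
  · rw [h.symm]
    exact this hj hi hij.symm hjn hin (by omega)
  by_cases hj1 : j = n - 1
  · subst hj1
    rcases h.plus_last_cases hi (by omega) <;> omega
  · have h1 := h.plus_last_cases hj (by omega)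
    have := h.isACol.bounds (i := i) (j := n - 1) hi (by omega) (by omega)
    rcases h.law i (n - 1) j hi (by omega) (by omega) (by omega) (by omega) (by omega) hjn
      with h3 | h3
    · omega
    · rw [h.symm] at h1
      omega

theorem finite_dCol (a n : ℕ) : (dCol a n).Finite := by
  refine ((finite_aCol a n).prod (finite_setOf_bounded n)).subset ?_
  rintro ⟨m, p⟩ h
  refine ⟨h.isACol, ?_⟩
  intro i j hij
  by_contra hc
  have h1 : a ≤ i ∧ a ≤ j ∧ i ≠ j ∧ i < n ∧ j < n := by
    by_contra h2
    exact hc (h.supp i j h2)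
  have := IsDCol.plus_lt h h1.1 h1.2.1 h1.2.2.1 h1.2.2.2.1 h1.2.2.2.2
  exact hij ⟨h1.2.2.2.1, h1.2.2.2.2, this⟩

/-! ### Type A colourings and Catalan numbers -/

/-- The restriction of a colouring to the indices in `[a, b)`. -/
def restr (a b : ℕ) (f : ℕ → ℕ → ℕ) (i j : ℕ) : ℕ :=
  if a ≤ i ∧ a ≤ j ∧ i < b ∧ j < b then f i j else 0

theorem restr_of_mem {a b : ℕ} {f : ℕ → ℕ → ℕ} {i j : ℕ} (h : a ≤ i ∧ a ≤ j ∧ i < b ∧ j < b) :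
    restr a b f i j = f i j := if_pos h

theorem IsACol.restr {a b a' b' : ℕ} {m : ℕ → ℕ → ℕ} (h : IsACol a b m) (ha : a ≤ a')
    (hb : b' ≤ b) : IsACol a' b' (restr a' b' m) where
  supp i j hij := by
    have := h.supp i j
    unfold _root_.restr
    split_ifs
    · exact this (by omega)
    · rfl
  simple i hi hib := by
    rw [restr_of_mem (by omega)]
    exact h.simple i (by omega) (by omega)
  law i j k hi hij hjk hk := by
    rw [restr_of_mem (by omega), restr_of_mem (by omega), restr_of_mem (by omega)]
    exact h.law i j k (by omega) hij hjk (by omega)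

theorem IsDCol.restr {a a' n : ℕ} {m p : ℕ → ℕ → ℕ} (h : IsDCol a n m p) (ha : a ≤ a') :
    IsDCol a' n (restr a' n m) (restr a' n p) where
  isACol := h.isACol.restr ha le_rfl
  supp i j hij := by
    have := h.supp i j
    unfold _root_.restr
    split_ifs
    · exact this (by omega)
    · rfl
  symm i j := by
    have := h.symm i j
    unfold _root_.restr
    split_ifs <;> first | rfl | omega
  simple han := by
    rw [restr_of_mem (by omega)]
    exact h.simple (by omega)
  law i j k hi hk hij hki hkj hj hkn := by
    rw [restr_of_mem (by omega), restr_of_mem (by omega), restr_of_mem (by omega)]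
    exact h.law i j k (by omega) (by omega) hij hki hkj hj hkn

/-- Glueing two type `A` colourings by giving all roots across `s` the colour `s`. -/
def glueA (s : ℕ) (a b : ℕ) (m₁ m₂ : ℕ → ℕ → ℕ) (i j : ℕ) : ℕ :=
  if j ≤ s then m₁ i j else if s < i then m₂ i j else if a ≤ i ∧ j < b then s else 0

theorem isACol_glueA {s a b : ℕ} {m₁ m₂ : ℕ → ℕ → ℕ} (has : a ≤ s) (hsb : s + 1 < b)
    (h₁ : IsACol a (s + 1) m₁) (h₂ : IsACol (s + 1) b m₂) : IsACol a b (glueA s a b m₁ m₂) where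
  supp i j hij := by
    have := h₁.supp i j
    have := h₂.supp i j
    unfold glueA
    split_ifs <;> first | rfl | omega
  simple i hi hib := by
    have := h₁.simple i
    have := h₂.simple i
    unfold glueA
    split_ifs <;> omega
  law i j k hi hij hjk hk := by
    have := h₁.law i j k
    have := h₂.law i j k
    unfold glueA
    split_ifs <;> omega

/-- Once the longest root has colour s, all roots across s have colour s, and the roots on either
side of s are coloured independently. -/
theorem ncard_aCol_fiber {s a b : ℕ} (has : a ≤ s) (hsb : s + 1 < b) :
    {m | IsACol a b m ∧ m a (b - 1) = s}.ncard =
      (aCol a (s + 1)).ncard * (aCol (s + 1) b).ncard := by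
  rw [← Set.ncard_prod]
  refine Set.BijOn.ncard_eq
    (f := fun m => (restr a (s + 1) m, restr (s + 1) b m)) ⟨?_, ?_, ?_⟩
  · rintro m ⟨hm, -⟩
    exact ⟨hm.restr le_rfl (by omega), hm.restr (by omega) le_rfl⟩
  · rintro m ⟨hm, hs⟩ m' ⟨hm', hs'⟩ heq
    simp only [Prod.mk.injEq] at heq
    funext i j
    by_cases hij : a ≤ i ∧ i < j ∧ j < b
    · by_cases hj : j ≤ s
      · have := congrFun (congrFun heq.1 i) j
        rwa [restr_of_mem (by omega), restr_of_mem (by omega)] at this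
      · by_cases hi : s < i
        · have := congrFun (congrFun heq.2 i) j
          rwa [restr_of_mem (by omega), restr_of_mem (by omega)] at this
        · rw [hm.eq_of_le_of_lt (l := b - 1) (by omega) (by omega) (by omega) (by omega) (by omega),
            hm'.eq_of_le_of_lt (l := b - 1) (by omega) (by omega) (by omega) (by omega) (by omega),
            hs, hs']
    · rw [hm.supp i j hij, hm'.supp i j hij]
  · rintro ⟨m₁, m₂⟩ ⟨h₁, h₂⟩
    replace h₁ : IsACol a (s + 1) m₁ := h₁
    replace h₂ : IsACol (s + 1) b m₂ := h₂
    refine ⟨glueA s a b m₁ m₂, ⟨isACol_glueA has hsb h₁ h₂, ?_⟩, ?_⟩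
    · unfold glueA
      split_ifs <;> omega
    · refine Prod.ext ?_ ?_ <;> funext i j
      · have := h₁.supp i j
        simp only [restr, glueA]
        split_ifs <;> omega
      · have := h₂.supp i j
        simp only [restr, glueA]
        split_ifs <;> omega

theorem ncard_aCol_of_le {a b : ℕ} (h : b ≤ a + 1) : (aCol a b).ncard = 1 := by
  rw [Set.ncard_eq_one]
  refine ⟨fun _ _ => 0, Set.ext fun m => ⟨fun hm => ?_, ?_⟩⟩
  · funext i j
    exact hm.supp i j (by omega)
  · rintro rfl
    exact ⟨fun _ _ _ => rfl, fun i _ _ => by omega, fun _ _ _ _ _ _ _ => Or.inl rfl⟩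

/-- A finite set is counted by the fibres of a function. -/
theorem ncard_eq_sum_fiber {α β : Type*} [DecidableEq β] {s : Set α} (hs : s.Finite) (f : α → β)
    (t : Finset β) (h : ∀ x ∈ s, f x ∈ t) :
    s.ncard = ∑ y ∈ t, {x | x ∈ s ∧ f x = y}.ncard := by
  classical
  rw [Set.ncard_eq_toFinset_card s hs,
    Finset.card_eq_sum_card_fiberwise (f := f) (t := t) (fun x hx => h x (by simpa using hx))]
  refine Finset.sum_congr rfl fun y _ => ?_
  rw [← Set.ncard_coe_finset]
  congr 1
  ext x
  simp

theorem ncard_aCol (a N : ℕ) : (aCol a (a + N + 1)).ncard = catalan N := by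
  induction N using Nat.strong_induction_on generalizing a with
  | _ N ih =>
    rcases N with _ | N
    · rw [ncard_aCol_of_le (by omega), catalan_zero]
    · rw [ncard_eq_sum_fiber (finite_aCol _ _) (fun m => m a (a + (N + 1)) - a)
        (Finset.range (N + 1)), catalan_succ', Finset.Nat.sum_antidiagonal_eq_sum_range_succ_mk]
      · refine Finset.sum_congr rfl fun k hk => ?_
        rw [Finset.mem_range] at hk
        have h1 := ncard_aCol_fiber (s := a + k) (a := a) (b := a + (N + 1) + 1) (by omega)
          (by omega)
        rw [ih k (by omega)] at h1
        have h2 := ih (N - k) (by omega) (a + k + 1)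
        rw [show a + k + 1 + (N - k) + 1 = a + (N + 1) + 1 by omega] at h2
        rw [h2] at h1
        rw [← h1]
        congr 1
        ext m
        refine and_congr_right fun hm => ?_
        have := IsACol.bounds hm (i := a) (j := a + (N + 1)) le_rfl (by omega) (by omega)
        simp only [Nat.add_sub_cancel]
        omega
      · intro m hm
        have := IsACol.bounds hm (i := a) (j := a + (N + 1)) le_rfl (by omega) (by omega)
        rw [Finset.mem_range]
        omega

/-! ### Gluing a type A block to a type D colouring -/

/-- The colour of the roots `e_i ± e_k` leaving the block `[a, t)` in a glued colouring. -/
def crossColor (s t i : ℕ) : ℕ := if i ≤ s then s else t - 1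

/-- The colouring is glued from one on `[a, t)` and one on `[t, n)` with cross colours given by
`s` and `t - 1`. -/
def IsGlued (s t a n : ℕ) (m p : ℕ → ℕ → ℕ) : Prop :=
  (∀ i k, a ≤ i → i < t → t ≤ k → k < n → m i k = crossColor s t i ∧ p i k = crossColor s t i) ∧
  ∀ i j, a ≤ i → a ≤ j → i ≠ j → i < t → j < t → p i j = max (crossColor s t i) (crossColor s t j)

def glueMinus (s t a n : ℕ) (m₁ m₂ : ℕ → ℕ → ℕ) (i j : ℕ) : ℕ :=
  if j < t then m₁ i j else if t ≤ i then m₂ i j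
  else if a ≤ i ∧ j < n then crossColor s t i else 0

def gluePlus (s t a n : ℕ) (p₂ : ℕ → ℕ → ℕ) (i j : ℕ) : ℕ :=
  if t ≤ i ∧ t ≤ j then p₂ i j
  else if a ≤ i ∧ a ≤ j ∧ i ≠ j ∧ i < n ∧ j < n then
    if t ≤ i then crossColor s t j else if t ≤ j then crossColor s t i
    else max (crossColor s t i) (crossColor s t j)
  else 0

/-- The cut colour: `t - 1`, or the colour of the longest root `e_a - e_{t-1}`. -/
def cutColor (ε : Prop) [Decidable ε] (t a : ℕ) (m : ℕ → ℕ → ℕ) : ℕ :=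
  if ε then m a (t - 1) else t - 1

section Glue

variable {s t a n i j : ℕ} {m₁ m₂ p₂ : ℕ → ℕ → ℕ}

theorem glueMinus_low (hj : j < t) : glueMinus s t a n m₁ m₂ i j = m₁ i j := if_pos hj

theorem glueMinus_high (hi : t ≤ i) (hij : i < j) : glueMinus s t a n m₁ m₂ i j = m₂ i j := by
  rw [glueMinus, if_neg (by omega), if_pos hi]

theorem glueMinus_cross (hi : a ≤ i) (hit : i < t) (hj : t ≤ j) (hjn : j < n) :
    glueMinus s t a n m₁ m₂ i j = crossColor s t i := by
  rw [glueMinus, if_neg (by omega), if_neg (by omega), if_pos (by omega)]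

theorem gluePlus_high (hi : t ≤ i) (hj : t ≤ j) : gluePlus s t a n p₂ i j = p₂ i j :=
  if_pos ⟨hi, hj⟩

theorem gluePlus_cross (hi : a ≤ i) (hit : i < t) (hj : t ≤ j) (hjn : j < n) :
    gluePlus s t a n p₂ i j = crossColor s t i := by
  rw [gluePlus, if_neg (by omega), if_pos (by omega), if_neg (by omega), if_pos hj]

theorem gluePlus_cross' (hi : a ≤ i) (hit : i < t) (hj : t ≤ j) (hjn : j < n) :
    gluePlus s t a n p₂ j i = crossColor s t i := by
  rw [gluePlus, if_neg (by omega), if_pos (by omega), if_pos hj]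

theorem gluePlus_low (hi : a ≤ i) (hj : a ≤ j) (hit : i < t) (hjt : j < t) (hij : i ≠ j)
    (htn : t ≤ n) :
    gluePlus s t a n p₂ i j = max (crossColor s t i) (crossColor s t j) := by
  rw [gluePlus, if_neg (by omega), if_pos (by omega), if_neg (by omega), if_neg (by omega)]

end Glue

/-- The condition `hcut` is what `law` demands of (e_i - e_j) + (e_j - e_k) with i ≤ s < j < t ≤ k,
where the sum has colour s and the second summand t - 1. The value t = n - 1 is excluded because the
simple root e_{n-2} + e_{n-1} would then leave the block and get a colour at most n - 2; t = n is
allowed. -/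
theorem isDCol_glue {s t a n : ℕ} {m₁ m₂ p₂ : ℕ → ℕ → ℕ} (hat : a < t) (htn : t ≤ n)
    (htn' : t + 1 ≠ n) (hst : s < t) (h₁ : IsACol a t m₁) (h₂ : IsDCol t n m₂ p₂)
    (hcut : ∀ i j, a ≤ i → i ≤ s → s < j → j < t → m₁ i j = s) :
    IsDCol a n (glueMinus s t a n m₁ m₂) (gluePlus s t a n p₂) where
  isACol :=
    { supp := fun i j hij => by
        have := h₁.supp i j
        have := h₂.isACol.supp i j
        unfold glueMinus
        split_ifs <;> first | rfl | omega
      simple := fun i hi hib => by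
        have := h₁.simple i
        have := h₂.isACol.simple i
        unfold glueMinus crossColor
        split_ifs <;> omega
      law := fun i j k hi hij hjk hk => by
        have := h₁.law i j k
        have := h₂.isACol.law i j k
        have := hcut i j
        unfold glueMinus crossColor
        split_ifs <;> omega }
  supp i j hij := by
    have := h₂.supp i j
    unfold gluePlus
    split_ifs <;> first | rfl | omega
  symm i j := by
    have := h₂.symm i j
    unfold gluePlus
    split_ifs <;> omega
  simple han := by
    have := h₂.simple
    unfold gluePlus crossColor
    split_ifs <;> omega
  law i j k hi hk hij hki hkj hj hkn := by
    have h4 := hcut i j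
    rcases lt_or_ge i t with hit | hit
    · rcases lt_or_ge j t with hjt | hjt <;> rcases lt_or_ge k t with hkt | hkt
      · rw [gluePlus_low hi hk hit hkt (by omega) htn, gluePlus_low (by omega) hk hjt hkt
          (by omega) htn, glueMinus_low hjt]
        unfold crossColor
        split_ifs <;> omega
      · rw [gluePlus_cross hi hit hkt hkn, gluePlus_cross (by omega) hjt hkt hkn,
          glueMinus_low hjt]
        unfold crossColor
        split_ifs <;> omega
      · rw [gluePlus_low hi hk hit hkt (by omega) htn, gluePlus_cross' hk hkt hjt hj,
          glueMinus_cross hi hit hjt hj]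
        omega
      · rw [gluePlus_cross hi hit hkt hkn, glueMinus_cross hi hit hjt hj]
        exact Or.inl rfl
    · rcases lt_or_ge k t with hkt | hkt
      · rw [gluePlus_cross' hk hkt hit (by omega), gluePlus_cross' hk hkt (by omega) hj]
        exact Or.inr rfl
      · rw [gluePlus_high hit hkt, gluePlus_high (by omega) hkt, glueMinus_high hit hij]
        exact h₂.law i j k hit hkt hij hki hkj hj hkn

/-- Restriction to block and tail is inverse to gluing: for each kind `ε` the cut is determined by
the block, and then so are all remaining colours. The predicate `Q` carries a side condition on the
colour of e_a - e_{t-1}, needed when t = n; `hε` makes that vector a root when the cut depends on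
it. -/
theorem ncard_isGlued (ε : Prop) [Decidable ε] {t a n : ℕ} (hat : a < t) (htn : t ≤ n)
    (htn' : t + 1 ≠ n) (hε : ε → a + 2 ≤ t) (Q : ℕ → Prop) :
    {c | c ∈ dCol a n ∧ IsGlued (cutColor ε t a c.1) t a n c.1 c.2 ∧ Q (c.1 a (t - 1))}.ncard =
      {m | m ∈ aCol a t ∧ Q (m a (t - 1))}.ncard * (dCol t n).ncard := by
  rw [← Set.ncard_prod]
  refine Set.BijOn.ncard_eq
    (f := fun c => (restr a t c.1, restr t n c.1, restr t n c.2)) ⟨?_, ?_, ?_⟩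
  · rintro ⟨m, p⟩ ⟨hc, -, hQ⟩
    refine ⟨⟨IsACol.restr (IsDCol.isACol hc) le_rfl htn, ?_⟩, IsDCol.restr hc hat.le⟩
    dsimp only
    rwa [restr_of_mem (by omega)]
  · rintro ⟨m, p⟩ ⟨hc, hg, -⟩ ⟨m', p'⟩ ⟨hc', hg', -⟩ heq
    replace hc : IsDCol a n m p := hc
    replace hc' : IsDCol a n m' p' := hc'
    simp only [Prod.mk.injEq] at heq
    obtain ⟨h1, h2, h3⟩ := heq
    have hcut : cutColor ε t a m = cutColor ε t a m' := by
      unfold cutColor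
      split_ifs with h
      · have h0 := hε h
        have := congrFun (congrFun h1 a) (t - 1)
        rwa [restr_of_mem (by omega), restr_of_mem (by omega)] at this
      · rfl
    simp only [hcut] at hg
    dsimp only at hg'
    generalize cutColor ε t a m' = s at hg hg'
    refine Prod.ext ?_ ?_ <;> funext i j <;> dsimp only
    · by_cases hij : a ≤ i ∧ i < j ∧ j < n
      · by_cases hj : j < t
        · have := congrFun (congrFun h1 i) j
          rwa [restr_of_mem (by omega), restr_of_mem (by omega)] at this
        · by_cases hi : t ≤ i
          · have := congrFun (congrFun h2 i) j
            rwa [restr_of_mem (by omega), restr_of_mem (by omega)] at this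
          · rw [(hg.1 i j (by omega) (by omega) (by omega) (by omega)).1,
              (hg'.1 i j (by omega) (by omega) (by omega) (by omega)).1]
      · rw [hc.isACol.supp i j hij, hc'.isACol.supp i j hij]
    · by_cases hij : a ≤ i ∧ a ≤ j ∧ i ≠ j ∧ i < n ∧ j < n
      · rcases lt_or_ge i t with hi | hi <;> rcases lt_or_ge j t with hj | hj
        · rw [hg.2 i j (by omega) (by omega) (by omega) hi hj,
            hg'.2 i j (by omega) (by omega) (by omega) hi hj]
        · rw [(hg.1 i j (by omega) (by omega) (by omega) (by omega)).2,
              (hg'.1 i j (by omega) (by omega) (by omega) (by omega)).2]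
        · rw [hc.symm, hc'.symm, (hg.1 j i (by omega) (by omega) (by omega) (by omega)).2,
              (hg'.1 j i (by omega) (by omega) (by omega) (by omega)).2]
        · have := congrFun (congrFun h3 i) j
          rwa [restr_of_mem (by omega), restr_of_mem (by omega)] at this
      · rw [hc.supp i j hij, hc'.supp i j hij]
  · rintro ⟨m₁, m₂, p₂⟩ ⟨⟨h₁, hQ⟩, h₂⟩
    replace h₁ : IsACol a t m₁ := h₁
    replace h₂ : IsDCol t n m₂ p₂ := h₂
    obtain ⟨s, hs⟩ : ∃ s, s = cutColor ε t a m₁ := ⟨_, rfl⟩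
    have hst : s = t - 1 ∨ a + 2 ≤ t ∧ s = m₁ a (t - 1) ∧ s < t - 1 := by
      unfold cutColor at hs
      split_ifs at hs with h
      · have := h₁.bounds (i := a) (j := t - 1) le_rfl (by have := hε h; omega) (by omega)
        have := hε h
        omega
      · exact Or.inl hs
    -- For s = t - 1 there is nothing across the cut; otherwise s is the colour of the longest root
    -- of the block.
    have hcut : ∀ i j, a ≤ i → i ≤ s → s < j → j < t → m₁ i j = s := by
      intro i j hi his hsj hj
      rcases hst with h | ⟨h, h', -⟩
      · omega
      · rw [h'] at his hsj ⊢
        exact h₁.eq_of_le_of_lt (by omega) hi his hsj (by omega)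
    refine ⟨(glueMinus s t a n m₁ m₂, gluePlus s t a n p₂),
      ⟨isDCol_glue hat htn htn' (by omega) h₁ h₂ hcut, ?_, ?_⟩, ?_⟩
    · have : cutColor ε t a (glueMinus s t a n m₁ m₂) = s := by
        rw [hs]
        unfold cutColor
        split_ifs with h
        · unfold glueMinus
          rw [if_pos (by omega)]
        · rfl
      dsimp only
      rw [this]
      refine ⟨fun i k hi hit htk hkn => ?_, fun i j hi hj hij hit hjt => ?_⟩
      · unfold glueMinus gluePlus
        constructor <;> split_ifs <;> omega
      · unfold gluePlus
        split_ifs <;> omega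
    · dsimp only
      rwa [glueMinus_low (by omega)]
    · refine Prod.ext ?_ (Prod.ext ?_ ?_) <;> funext i j
      · have := h₁.supp i j
        simp only [restr, glueMinus]
        split_ifs <;> omega
      · have := h₂.isACol.supp i j
        simp only [restr, glueMinus]
        split_ifs <;> omega
      · have := h₂.supp i j
        simp only [restr, gluePlus]
        split_ifs <;> omega

theorem dCol_self (n : ℕ) : dCol n n = {(fun _ _ => 0, fun _ _ => 0)} := by
  refine Set.ext fun c => ⟨fun hc => ?_, ?_⟩
  · replace hc : IsDCol n n c.1 c.2 := hc
    refine Prod.ext ?_ ?_ <;> funext i j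
    · exact hc.isACol.supp i j (by omega)
    · exact hc.supp i j (by omega)
  · rintro rfl
    exact ⟨⟨fun _ _ _ => rfl, fun i _ _ => by omega, fun _ _ _ _ _ _ _ => Or.inl rfl⟩,
      fun _ _ _ => rfl, fun _ _ => rfl, fun _ => by omega, fun _ _ _ _ _ _ _ _ _ _ => Or.inl rfl⟩

/-! ### Every colouring with m a (n-1) = p a (n-1) or p a (n-1) = n - 1 is glued -/

/-- The first and last cross roots `e_a ± e_{n-1}` having the same colour: the colouring is
glued along a proper block. -/
theorem IsDCol.isGlued_of_eq {a n : ℕ} {m p : ℕ → ℕ → ℕ} (h : IsDCol a n m p) (han : a + 3 ≤ n)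
    (huv : m a (n - 1) = p a (n - 1)) :
    (p a (n - 1) + 3 ≤ n ∧ p a (p a (n - 1) + 1) = p a (n - 1) ∧
      IsGlued (p a (n - 1)) (p a (n - 1) + 1) a n m p) ∨
    (a + 1 ≤ p a (p a (n - 1) + 1) ∧ p a (p a (n - 1) + 1) + 3 ≤ n ∧
      p a (p a (n - 1) + 1) ≠ p a (n - 1) ∧
      IsGlued (m a (p a (p a (n - 1) + 1))) (p a (p a (n - 1) + 1) + 1) a n m p) := by
  obtain ⟨s, hs⟩ : ∃ s, s = m a (n - 1) := ⟨_, rfl⟩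
  have hb := h.isACol.bounds (i := a) (j := n - 1) le_rfl (by omega) (by omega)
  have hpl := h.plus_last_cases (i := a) le_rfl (by omega)
  have hps : p a (n - 1) = s := by omega
  rw [hps]
  -- colours across `s`
  have hm : ∀ i j, a ≤ i → i ≤ s → s < j → j < n → m i j = s := by
    intro i j hi his hsj hj
    rw [hs] at his hsj ⊢
    exact h.isACol.eq_of_le_of_lt (by omega) hi his hsj (by omega)
  -- In e_a + e_{n-1} = (e_a - e_i) + (e_i + e_{n-1}) the first summand has a colour below i ≤ s.
  have hpn : ∀ i, a ≤ i → i ≤ s → p i (n - 1) = s := by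
    intro i hi his
    rcases hi.eq_or_lt with rfl | hai
    · exact hps
    · have := h.isACol.bounds (i := a) (j := i) le_rfl hai (by omega)
      rcases h.law a i (n - 1) le_rfl (by omega) (by omega) (by omega) (by omega) (by omega)
        (by omega) with h3 | h3 <;> omega
  -- `p i k` for `i ≤ s`
  have hpk : ∀ i k, a ≤ i → i ≤ s → a ≤ k → k + 1 < n → k ≠ i →
      (p i k = s ∨ p i k = m k (n - 1)) ∧ (p i k = s ∨ p i k = p k (n - 1)) := by
    intro i k hi his hk hkn hki
    have h1 := h.law k (n - 1) i hk hi (by omega) (by omega) (by omega) (by omega) (by omega)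
    have h2 := h.law i (n - 1) k hi hk (by omega) (by omega) (by omega) (by omega) (by omega)
    rw [h.symm k i, h.symm (n - 1) i, hpn i hi his] at h1
    rw [h.symm (n - 1) k, hm i (n - 1) hi his (by omega) (by omega)] at h2
    tauto
  have hlow : ∀ i k, a ≤ i → i ≤ s → a ≤ k → k ≤ s → k ≠ i → p i k = s := by
    intro i k hi his hk hks hki
    have := (hpk i k hi his hk (by omega) hki).2
    rw [hpn k hk hks] at this
    tauto
  -- Here p a k is s or m k (n-1) ≥ k > s, so it is never the colour of e_a - e_i, which is below s.
  have hindep : ∀ i k, a ≤ i → i ≤ s → s < k → k < n → p i k = p a k := by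
    intro i k hi his hsk hkn
    rcases hi.eq_or_lt with rfl | hai
    · rfl
    have h1 := h.isACol.bounds (i := a) (j := i) le_rfl hai (by omega)
    by_cases hk1 : k = n - 1
    · subst hk1
      rw [hpn i hi his, hps]
    have h2 := hpk a k le_rfl (by omega) (by omega) (by omega) (by omega)
    have h3 := h.isACol.bounds (i := k) (j := n - 1) (by omega) (by omega) (by omega)
    rcases h.law a i k le_rfl (by omega) (by omega) (by omega) (by omega) (by omega)
        (by omega) with h4 | h4 <;> omega
  -- The indices k > s with p a k ≠ s decide the kind of gluing. If there are none, the block ends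
  -- at s. Otherwise they turn out to form the interval (s, r], where r is their common value of p a
  -- k, and the block ends at r.
  by_cases hT : ∀ k, s < k → k < n → p a k = s
  · left
    refine ⟨by omega, hT _ (by omega) (by omega), ?_, ?_⟩
    · intro i k hi his hsk hkn
      rw [crossColor, if_pos (by omega)]
      exact ⟨hm i k hi (by omega) (by omega) hkn,
        (hindep i k hi (by omega) (by omega) hkn).trans (hT k (by omega) hkn)⟩
    · intro i j hi hj hij his hjs
      rw [crossColor, crossColor, if_pos (by omega), if_pos (by omega), max_self]
      exact hlow i j hi (by omega) hj (by omega) hij.symm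
  · right
    push Not at hT
    obtain ⟨k₀, hk₀s, hk₀n, hk₀⟩ := hT
    have hk₀1 : k₀ ≠ n - 1 := by
      rintro rfl
      exact hk₀ hps
    have hA := hpk a k₀ le_rfl (by omega) (by omega) (by omega) (by omega)
    obtain ⟨r, hr⟩ : ∃ r, r = p a k₀ := ⟨_, rfl⟩
    rw [← hr] at hA hk₀
    have hrb := h.isACol.bounds (i := k₀) (j := n - 1) (by omega) (by omega) (by omega)
    have hrl := h.plus_last_cases (i := k₀) (by omega) (by omega)
    have hmr : m k₀ (n - 1) = r := by tauto
    -- all other plus roots above `s`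
    have hstar : ∀ k j, s < k → k < n → p a k ≠ s → s < j → j < n → j ≠ k →
        p j k = p a k := by
      intro k j hk hkn hkr hj hjn hjk
      have := h.law a j k le_rfl (by omega) (by omega) (by omega) (by omega) (by omega) (by omega)
      rw [hm a j le_rfl (by omega) hj hjn] at this
      omega
    -- If p a j were s, comparing e_a + e_j with e_a + e_{k₀} through their difference would force a
    -- colour outside the support of that difference.
    have hT1 : ∀ j, s < j → j ≤ r → p a j = r := by
      intro j hj hjr
      by_contra hne
      have h1 := hpk a j le_rfl (by omega) (by omega) (by omega) (by omega)
      have hjk : j ≠ k₀ := by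
        rintro rfl
        exact hne hr.symm
      have h2 := hstar k₀ j hk₀s hk₀n (by omega) hj (by omega) hjk
      have hjs : p a j = s := by
        by_contra hjs
        have h7 := hstar j k₀ hj (by omega) hjs hk₀s hk₀n (Ne.symm hjk)
        rw [h.symm k₀ j, h2] at h7
        omega
      rcases lt_or_gt_of_ne hjk with hlt | hgt
      · have h3 := h.law j k₀ a (by omega) le_rfl hlt (by omega) (by omega) (by omega) (by omega)
        have h4 := h.isACol.bounds (i := j) (j := k₀) (by omega) hlt (by omega)
        rw [h.symm j a, h.symm k₀ a] at h3
        omega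
      · have h3 := h.law k₀ j a (by omega) le_rfl hgt (by omega) (by omega) (by omega) (by omega)
        have h4 := h.isACol.bounds (i := k₀) (j := j) (by omega) hgt (by omega)
        rw [h.symm j a, h.symm k₀ a] at h3
        omega
    -- If p a j ≠ s, two uses of `hstar` give p a j = p a k₀ = r, whereas p a j = m j (n-1) ≥ j > r.
    have hT2 : ∀ j, r < j → j < n → p a j = s := by
      intro j hj hjn
      by_contra hne
      have hj1 : j ≠ n - 1 := by
        rintro rfl
        exact hne hps
      have h1 := hpk a j le_rfl (by omega) (by omega) (by omega) (by omega)
      have h2 := hstar j k₀ (by omega) hjn hne hk₀s hk₀n (by omega)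
      have h3 := hstar k₀ j hk₀s hk₀n (by omega) (by omega) hjn (by omega)
      have h4 := h.isACol.bounds (i := j) (j := n - 1) (by omega) (by omega) (by omega)
      rw [h.symm] at h3
      omega
    have hsr : p a (s + 1) = r := hT1 _ (by omega) (by omega)
    rw [hsr, hm a r le_rfl (by omega) (by omega) (by omega)]
    refine ⟨by omega, by omega, by omega, ?_, ?_⟩
    · intro i k hi hir hrk hkn
      unfold crossColor
      split_ifs with his
      · exact ⟨hm i k hi his (by omega) hkn,
          (hindep i k hi his (by omega) hkn).trans (hT2 k (by omega) hkn)⟩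
      · have h0 := hT1 i (by omega) (by omega)
        have h1 := hstar i k (by omega) (by omega) (by omega) (by omega) hkn (by omega)
        rw [h.symm] at h1
        refine ⟨?_, by omega⟩
        have h2 := h.law i k a (by omega) le_rfl (by omega) (by omega) (by omega) (by omega)
          (by omega)
        rw [h.symm i a, h.symm k a, hT1 i (by omega) (by omega), hT2 k (by omega) hkn] at h2
        omega
    · intro i j hi hj hij hir hjr
      unfold crossColor
      split_ifs with his hjs hjs
      · rw [max_self]
        exact hlow i j hi his hj hjs hij.symm
      · rw [hindep i j hi his (by omega) (by omega), hT1 j (by omega) (by omega)]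
        omega
      · rw [h.symm, hindep j i hj hjs (by omega) (by omega), hT1 i (by omega) (by omega)]
        omega
      · have h0 := hT1 j (by omega) (by omega)
        rw [hstar j i (by omega) (by omega) (by omega) (by omega) (by omega) hij]
        omega

/-- The root `e_a + e_{n-1}` having the last colour: the colouring is glued along the whole
index range. -/
theorem IsDCol.isGlued_of_last {a n : ℕ} {m p : ℕ → ℕ → ℕ} (h : IsDCol a n m p) (han : a + 3 ≤ n)
    (hv : p a (n - 1) = n - 1) :
    IsGlued (n - 1) n a n m p ∨ (m a (n - 1) ≠ a ∧ IsGlued (m a (n - 1)) n a n m p) := by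
  obtain ⟨s, hs⟩ : ∃ s, s = m a (n - 1) := ⟨_, rfl⟩
  rw [← hs]
  have hb := h.isACol.bounds (i := a) (j := n - 1) le_rfl (by omega) (by omega)
  have hm : ∀ i j, a ≤ i → i ≤ s → s < j → j < n → m i j = s := by
    intro i j hi his hsj hj
    rw [hs] at his hsj ⊢
    exact h.isACol.eq_of_le_of_lt (by omega) hi his hsj (by omega)
  have hpn : ∀ i, a ≤ i → i + 1 < n → p i (n - 1) = n - 1 := by
    intro i hi hin
    rcases hi.eq_or_lt with rfl | hai
    · exact hv
    · have := h.isACol.bounds (i := a) (j := i) le_rfl hai (by omega)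
      rcases h.law a i (n - 1) le_rfl (by omega) (by omega) (by omega) (by omega) (by omega)
        (by omega) with h3 | h3 <;> omega
  have hmn : ∀ i j, a ≤ i → a ≤ j → i ≠ j → i + 1 < n → j + 1 < n →
      p i j = m i (n - 1) ∨ p i j = n - 1 := by
    intro i j hi hj hij hin hjn
    have := h.law i (n - 1) j hi hj (by omega) (by omega) (by omega) (by omega) (by omega)
    rwa [h.symm (n - 1) j, hpn j hj hjn] at this
  -- Passing through the index n - 1 in two ways leaves the options {s, n - 1} and {m j (n-1), n -
  -- 1}, and m j (n-1) ≥ j > s.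
  have hmixed : ∀ i j, a ≤ i → i ≤ s → s < j → j < n → p i j = n - 1 := by
    intro i j hi his hsj hj
    by_cases hj1 : j = n - 1
    · subst hj1
      exact hpn i hi (by omega)
    have h1 := hmn i j hi (by omega) (by omega) (by omega) (by omega)
    have h2 := hmn j i (by omega) (by omega) (by omega) (by omega) (by omega)
    rw [hm i (n - 1) hi his (by omega) (by omega)] at h1
    have := h.isACol.bounds (i := j) (j := n - 1) (by omega) (by omega) (by omega)
    rw [h.symm j i] at h2
    omega
  have hhigh : ∀ i j, s < i → i < n → s < j → j < n → i ≠ j → p i j = n - 1 := by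
    intro i j hi hin hj hjn hij
    have h1 := h.law a i j le_rfl (by omega) (by omega) (by omega) (by omega) (by omega) (by omega)
    rw [hm a i le_rfl (by omega) hi hin, hmixed a j le_rfl (by omega) hj hjn] at h1
    omega
  have hstep : ∀ i j, a < i → i ≤ s → a < j → j ≤ s → i ≠ j → p i j = p a j := by
    intro i j hi his hj hjs hij
    have h1 := h.isACol.bounds (i := a) (j := i) le_rfl hi (by omega)
    have h2 := h.law a i j le_rfl (by omega) (by omega) (by omega) (by omega) (by omega) (by omega)
    have h3 := hmn a j le_rfl (by omega) (by omega) (by omega) (by omega)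
    omega
  have hconst : ∀ j, a < j → j ≤ s → p a j = p a (a + 1) := by
    intro j hj hjs
    by_cases hj1 : j = a + 1
    · rw [hj1]
    have h1 := hstep j (a + 1) hj hjs (by omega) (by omega) hj1
    have h2 := hstep (a + 1) j (by omega) (by omega) hj hjs (Ne.symm hj1)
    rw [h.symm] at h2
    omega
  have hlow : ∀ i j, a ≤ i → i ≤ s → a ≤ j → j ≤ s → i ≠ j → p i j = p a (a + 1) := by
    intro i j hi his hj hjs hij
    by_cases hia : i = a
    · subst hia
      exact hconst j (by omega) hjs
    · by_cases hja : j = a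
      · subst hja
        rw [h.symm]
        exact hconst i (by omega) his
      · rw [hstep i j (by omega) his (by omega) hjs hij]
        exact hconst j (by omega) hjs
  -- All plus roots with both indices at most s share one colour, either s or n - 1; every other
  -- plus root has colour n - 1. This bit is the only freedom besides `m`.
  by_cases hz : p a (a + 1) = n - 1
  · left
    refine ⟨fun i k _ _ _ _ => by omega, fun i j hi hj hij hin hjn => ?_⟩
    rw [crossColor, crossColor, if_pos (by omega), if_pos (by omega), max_self]
    rcases le_or_gt i s with his | his <;> rcases le_or_gt j s with hjs | hjs
    · rw [hlow i j hi his hj hjs hij, hz]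
    · exact hmixed i j hi his hjs hjn
    · rw [h.symm]
      exact hmixed j i hj hjs his hin
    · exact hhigh i j his hin hjs hjn hij
  · right
    have hsa : a < s := by
      by_contra hsa
      exact hz (hmixed a (a + 1) le_rfl (by omega) (by omega) (by omega))
    have hzs : p a (a + 1) = s := by
      have := hmn a (a + 1) le_rfl (by omega) (by omega) (by omega) (by omega)
      omega
    refine ⟨by omega, fun i k _ _ _ _ => by omega, fun i j hi hj hij hin hjn => ?_⟩
    unfold crossColor
    split_ifs with his hjs hjs
    · rw [hlow i j hi his hj hjs hij, hzs, max_self]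
    · rw [hmixed i j hi his (by omega) hjn]
      omega
    · rw [h.symm, hmixed j i hj hjs (by omega) hin]
      omega
    · rw [hhigh i j (by omega) hin (by omega) hjn hij, max_self]

/-- Split both roots at n - 2. Since v ≠ n - 1, v is the colour of e_a - e_{n-2}; since u ≠ v, u
must be the colour of e_{n-2} - e_{n-1}. -/
theorem IsDCol.minus_last_of_ne {a n : ℕ} {m p : ℕ → ℕ → ℕ} (h : IsDCol a n m p)
    (han : a + 3 ≤ n) (huv : m a (n - 1) ≠ p a (n - 1)) (hv : p a (n - 1) ≠ n - 1) :
    m a (n - 1) = n - 2 := by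
  have h1 := h.plus_last_cases (i := a) le_rfl (by omega)
  have h2 := h.isACol.bounds (i := a) (j := n - 1) le_rfl (by omega) (by omega)
  have h3 := h.law a (n - 2) (n - 1) le_rfl (by omega) (by omega) (by omega) (by omega) (by omega)
    (by omega)
  have h4 := h.isACol.law a (n - 2) (n - 1) le_rfl (by omega) (by omega) (by omega)
  have h5 := h.simple (by omega)
  have h6 := h.isACol.bounds (i := n - 2) (j := n - 1) (by omega) (by omega) (by omega)
  omega

/-! ### The diagram automorphism -/

/-- The transposition of the last two colours. -/
def swapLabel (n x : ℕ) : ℕ := if x = n - 1 then n - 2 else if x = n - 2 then n - 1 else x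

theorem swapLabel_swapLabel (n x : ℕ) : swapLabel n (swapLabel n x) = x := by
  unfold swapLabel
  split_ifs <;> omega

/-- The effect on colourings of the diagram automorphism `e_{n-1} ↦ -e_{n-1}`. -/
def swapCol (n : ℕ) (c : (ℕ → ℕ → ℕ) × (ℕ → ℕ → ℕ)) : (ℕ → ℕ → ℕ) × (ℕ → ℕ → ℕ) :=
  (fun i j => swapLabel n (if j = n - 1 ∧ i < j then c.2 i j else c.1 i j),
    fun i j => swapLabel n (if i = n - 1 then c.1 j i else if j = n - 1 then c.1 i j else c.2 i j))

theorem swapCol_mem {a n : ℕ} (han : a + 3 ≤ n) {c : (ℕ → ℕ → ℕ) × (ℕ → ℕ → ℕ)}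
    (hc : c ∈ dCol a n) : swapCol n c ∈ dCol a n := by
  obtain ⟨m, p⟩ := c
  replace hc : IsDCol a n m p := hc
  -- The default value 0 off the support must survive the swap of colours; this uses n ≥ 3.
  have h0 : swapLabel n 0 = 0 := by
    unfold swapLabel
    split_ifs <;> omega
  have key : ∀ x y z : ℕ, x = y ∨ x = z →
      swapLabel n x = swapLabel n y ∨ swapLabel n x = swapLabel n z := by
    rintro x y z (rfl | rfl)
    · exact Or.inl rfl
    · exact Or.inr rfl
  refine ⟨⟨fun i j hij => ?_, fun i hi hin => ?_, fun i j k hi hij hjk hk => ?_⟩,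
    fun i j hij => ?_, fun i j => ?_, fun _ => ?_, fun i j k hi hk hij hki hkj hj hkn => ?_⟩ <;>
    dsimp only [swapCol]
  · have h1 := hc.supp i j
    have h2 := hc.isACol.supp i j
    rw [← h0]
    congr 1
    split_ifs <;> omega
  · have h1 := hc.simple (by omega)
    have h2 := hc.isACol.simple i hi hin
    split_ifs with h
    · rw [show i = n - 2 by omega, show n - 2 + 1 = n - 1 by omega, h1]
      unfold swapLabel
      split_ifs <;> omega
    · rw [h2]
      unfold swapLabel
      split_ifs <;> omega
  · apply key
    rw [if_neg (c := j = n - 1 ∧ i < j) (by omega)]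
    split_ifs with h1 h2 h2
    · exact hc.law i j k hi (by omega) hij (by omega) (by omega) (by omega) hk
    · omega
    · omega
    · exact hc.isACol.law i j k hi hij hjk hk
  · have h1 := hc.supp i j
    have h2 := hc.isACol.supp i j
    have h3 := hc.isACol.supp j i
    rw [← h0]
    congr 1
    split_ifs <;> omega
  · congr 1
    have := hc.symm i j
    split_ifs <;> first | rfl | omega | (subst_vars; rfl)
  · rw [if_neg (by omega), if_pos rfl]
    have h2 := hc.isACol.simple (n - 2) (by omega) (by omega)
    rw [show n - 2 + 1 = n - 1 by omega] at h2
    rw [h2]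
    unfold swapLabel
    split_ifs <;> omega
  · apply key
    rw [if_neg (c := i = n - 1) (by omega)]
    by_cases hk1 : k = n - 1
    · rw [if_pos hk1, if_neg (by omega), if_neg (by omega), if_pos hk1]
      exact hc.isACol.law i j k hi hij (by omega) hkn
    · rw [if_neg hk1]
      by_cases hj1 : j = n - 1
      · rw [if_pos ⟨hj1, hij⟩, if_pos hj1, hc.symm i k, hc.symm i j]
        exact (hc.law k j i hk hi (by omega) (by omega) (by omega) hj (by omega)).symm
      · rw [if_neg (by omega), if_neg hj1, if_neg hk1]
        exact hc.law i j k hi hk hij hki hkj hj hkn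

theorem swapCol_swapCol {a n : ℕ} {c : (ℕ → ℕ → ℕ) × (ℕ → ℕ → ℕ)} (hc : c ∈ dCol a n) :
    swapCol n (swapCol n c) = c := by
  obtain ⟨m, p⟩ := c
  replace hc : IsDCol a n m p := hc
  refine Prod.ext ?_ ?_ <;> funext i j <;> dsimp only [swapCol]
  · split_ifs <;> simp only [swapLabel_swapLabel] <;> first | rfl | omega
  · have h1 := hc.supp i j
    have h2 := hc.isACol.supp i j
    have h3 := hc.isACol.supp j i
    have h4 := hc.symm i j
    split_ifs <;> simp only [swapLabel_swapLabel] <;> omega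

/-! ### Counting type D colourings and the recurrence -/

/-- Colourings in which `e_a + e_{n-1}` has the last colour. -/
theorem ncard_dCol_last {a n : ℕ} (han : a + 3 ≤ n) (Q : ℕ → Prop) :
    {c | c ∈ dCol a n ∧ c.2 a (n - 1) = n - 1 ∧ Q (c.1 a (n - 1))}.ncard =
      {m | m ∈ aCol a n ∧ Q (m a (n - 1))}.ncard +
        {m | m ∈ aCol a n ∧ m a (n - 1) ≠ a ∧ Q (m a (n - 1))}.ncard := by
  have h1 := ncard_isGlued False (t := n) (n := n) (a := a) (by omega) le_rfl (by omega)
    (by omega) Q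
  -- For s = a no plus root has both indices at most s, so both kinds of gluing coincide; requiring
  -- s ≠ a avoids counting these twice.
  have h2 := ncard_isGlued True (t := n) (n := n) (a := a) (by omega) le_rfl (by omega)
    (by omega) (fun x => x ≠ a ∧ Q x)
  rw [dCol_self, Set.ncard_singleton, mul_one] at h1 h2
  rw [← h1, ← h2, ← Set.ncard_union_eq ?_
    ((finite_dCol a n).subset fun c hc => hc.1) ((finite_dCol a n).subset fun c hc => hc.1)]
  · congr 1
    ext ⟨m, p⟩
    simp only [Set.mem_ofPred_eq, Set.mem_union, cutColor, if_true, if_false]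
    constructor
    · rintro ⟨hc, hv, hQ⟩
      rcases IsDCol.isGlued_of_last hc han hv with h | ⟨h, h'⟩
      · exact Or.inl ⟨hc, h, hQ⟩
      · exact Or.inr ⟨hc, h', h, hQ⟩
    · rintro (⟨hc, hg, hQ⟩ | ⟨hc, hg, hs, hQ⟩)
      · refine ⟨hc, ?_, hQ⟩
        rw [hg.2 a (n - 1) le_rfl (by omega) (by omega) (by omega) (by omega)]
        unfold crossColor
        split_ifs <;> omega
      · refine ⟨hc, ?_, hQ⟩
        have := (IsDCol.isACol hc).bounds (i := a) (j := n - 1) le_rfl (by omega) (by omega)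
        dsimp only at this
        rw [hg.2 a (n - 1) le_rfl (by omega) (by omega) (by omega) (by omega)]
        unfold crossColor
        split_ifs <;> omega
  · rw [Set.disjoint_left]
    rintro ⟨m, p⟩ ⟨hc, hg, -⟩ ⟨-, hg', hs, -⟩
    have := (IsDCol.isACol hc).bounds (i := a) (j := n - 1) le_rfl (by omega) (by omega)
    -- The root e_a + e_{a+1} separates the kinds: its colour is n - 1 in the first and s < n - 1 in
    -- the second.
    have h1 := hg.2 a (a + 1) le_rfl (by omega) (by omega) (by omega) (by omega)
    have h2 := hg'.2 a (a + 1) le_rfl (by omega) (by omega) (by omega) (by omega)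
    simp only [crossColor, cutColor, if_true, if_false] at this h1 h2 hs
    split_ifs at h1 h2 <;> omega

theorem ncard_aCol_first (a N : ℕ) :
    {m | m ∈ aCol a (a + N + 2) ∧ m a (a + N + 2 - 1) = a}.ncard = catalan N := by
  have h := ncard_aCol_fiber (s := a) (a := a) (b := a + N + 2) le_rfl (by omega)
  have h1 := ncard_aCol (a + 1) N
  rw [show a + 1 + N + 1 = a + N + 2 by omega] at h1
  rwa [ncard_aCol_of_le le_rfl, one_mul, h1] at h

theorem ncard_aCol_last (a N : ℕ) :
    {m | m ∈ aCol a (a + N + 2) ∧ m a (a + N + 2 - 1) = a + N}.ncard = catalan N := by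
  have h := ncard_aCol_fiber (s := a + N) (a := a) (b := a + N + 2) (by omega) (by omega)
  rwa [ncard_aCol_of_le (b := a + N + 2) (by omega), mul_one, ncard_aCol] at h

theorem ncard_aCol_not_first (a N : ℕ) :
    {m | m ∈ aCol a (a + N + 2) ∧ m a (a + N + 2 - 1) ≠ a}.ncard + catalan N =
      catalan (N + 1) := by
  rw [← ncard_aCol_first a N, ← ncard_aCol a (N + 1), ← Set.ncard_union_eq ?_
    ((finite_aCol _ _).subset fun c hc => hc.1) ((finite_aCol _ _).subset fun c hc => hc.1)]
  · congr 1
    ext m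
    simp only [Set.mem_union, Set.mem_ofPred_eq, show a + (N + 1) + 1 = a + N + 2 by omega]
    tauto
  · rw [Set.disjoint_left]
    exact fun m h h' => h.2 h'.2

/-- Colourings in which `e_a - e_{n-1}` and `e_a + e_{n-1}` have different colours. -/
theorem ncard_dCol_ne (a N : ℕ) :
    {c | c ∈ dCol a (a + N + 3) ∧ c.1 a (a + N + 3 - 1) ≠ c.2 a (a + N + 3 - 1)}.ncard +
      4 * catalan (N + 1) = 4 * catalan (N + 2) := by
  obtain ⟨n, hn⟩ : ∃ n, n = a + N + 3 := ⟨_, rfl⟩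
  rw [← hn]
  have han : a + 3 ≤ n := by omega
  obtain ⟨U, hU⟩ : ∃ U, U = {c | c ∈ dCol a n ∧ c.2 a (n - 1) = n - 1} := ⟨_, rfl⟩
  obtain ⟨W, hW⟩ : ∃ W, W = {c | c ∈ dCol a n ∧ c.1 a (n - 1) = n - 2} := ⟨_, rfl⟩
  have hUf : U.Finite := by
    rw [hU]
    exact (finite_dCol a n).subset fun c hc => hc.1
  have hWf : W.Finite := by
    rw [hW]
    exact (finite_dCol a n).subset fun c hc => hc.1
  have hset : {c | c ∈ dCol a n ∧ c.1 a (n - 1) ≠ c.2 a (n - 1)} = U ∪ W := by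
    ext ⟨m, p⟩
    rw [hU, hW]
    simp only [Set.mem_ofPred_eq, Set.mem_union]
    constructor
    · rintro ⟨hc, h⟩
      by_cases hv : p a (n - 1) = n - 1
      · exact Or.inl ⟨hc, hv⟩
      · exact Or.inr ⟨hc, IsDCol.minus_last_of_ne hc han h hv⟩
    · rintro (⟨hc, h⟩ | ⟨hc, h⟩)
      · have := (IsDCol.isACol hc).bounds (i := a) (j := n - 1) le_rfl (by omega) (by omega)
        dsimp only at this
        exact ⟨hc, by omega⟩
      · have := IsDCol.plus_last_cases hc (i := a) le_rfl (by omega)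
        dsimp only at this
        exact ⟨hc, by omega⟩
  have hWU : W.ncard = U.ncard := by
    refine Set.BijOn.ncard_eq (f := swapCol n) (Set.InvOn.bijOn (f' := swapCol n) ⟨?_, ?_⟩ ?_ ?_)
    · intro c hc
      rw [hW] at hc
      exact swapCol_swapCol hc.1
    · intro c hc
      rw [hU] at hc
      exact swapCol_swapCol hc.1
    · intro c hc
      rw [hW] at hc
      rw [hU]
      refine ⟨swapCol_mem han hc.1, ?_⟩
      dsimp only [swapCol]
      rw [if_neg (by omega), if_pos rfl, hc.2]
      unfold swapLabel
      split_ifs <;> omega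
    · intro c hc
      rw [hU] at hc
      rw [hW]
      refine ⟨swapCol_mem han hc.1, ?_⟩
      dsimp only [swapCol]
      rw [if_pos ⟨rfl, by omega⟩, hc.2]
      unfold swapLabel
      split_ifs <;> omega
  have h1 := ncard_dCol_last han (fun _ => True)
  have h2 := ncard_dCol_last han (fun x => x = n - 2)
  have h3 : {m | m ∈ aCol a n ∧ m a (n - 1) ≠ a ∧ m a (n - 1) = n - 2} =
      {m | m ∈ aCol a n ∧ m a (n - 1) = n - 2} := by
    ext m
    simp only [Set.mem_ofPred_eq]
    refine and_congr_right fun _ => ?_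
    omega
  have h4 : {c | c ∈ dCol a n ∧ c.2 a (n - 1) = n - 1 ∧ c.1 a (n - 1) = n - 2} = U ∩ W := by
    ext c
    rw [hU, hW]
    simp only [Set.mem_ofPred_eq, Set.mem_inter_iff]
    tauto
  have h5 := ncard_aCol_last a (N + 1)
  have h6 := ncard_aCol_not_first a (N + 1)
  have h7 := ncard_aCol a (N + 2)
  rw [show a + (N + 1) + 2 = n by omega] at h5 h6
  rw [show a + (N + 1) = n - 2 by omega] at h5
  rw [show a + (N + 2) + 1 = n by omega] at h7
  simp only [and_true, Set.ofPred_mem_eq] at h1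
  rw [← hU, h7] at h1
  rw [h3, h4, h5] at h2
  -- With C the Catalan numbers, U and W each have 2 C (N+2) - C (N+1) elements and their
  -- intersection has 2 C (N+1).
  have h8 := Set.ncard_union_add_ncard_inter U W hUf hWf
  rw [hset]
  rw [show N + 1 + 1 = N + 2 from rfl] at h6
  omega

/-- Colourings in which `e_a - e_{n-1}` and `e_a + e_{n-1}` have the same colour. -/
theorem ncard_dCol_eq (a N : ℕ) :
    {c | c ∈ dCol a (a + N + 3) ∧ c.1 a (a + N + 3 - 1) = c.2 a (a + N + 3 - 1)}.ncard =
      (dCol (a + 1) (a + N + 3)).ncard +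
        2 * ∑ k ∈ Finset.range N, catalan (k + 1) * (dCol (a + k + 2) (a + N + 3)).ncard := by
  obtain ⟨n, hn⟩ : ∃ n, n = a + N + 3 := ⟨_, rfl⟩
  rw [← hn]
  have han : a + 3 ≤ n := by omega
  -- With v = p a (n-1), the colour of e_a + e_{v+1} is t - 1 for both kinds of gluing, and it
  -- equals v exactly for the kind with s = t - 1. So this pair recovers block and kind.
  rw [ncard_eq_sum_fiber ((finite_dCol a n).subset fun c hc => hc.1)
    (fun c => (c.2 a (c.2 a (n - 1) + 1) - a,
      decide (c.2 a (c.2 a (n - 1) + 1) = c.2 a (n - 1))))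
    (Finset.range (N + 1) ×ˢ Finset.univ), Finset.sum_product]
  · have hI : ∀ k ≤ N, {c | c ∈ {c | c ∈ dCol a n ∧ c.1 a (n - 1) = c.2 a (n - 1)} ∧
        (c.2 a (c.2 a (n - 1) + 1) - a,
          decide (c.2 a (c.2 a (n - 1) + 1) = c.2 a (n - 1))) = (k, true)}.ncard =
        catalan k * (dCol (a + k + 1) n).ncard := by
      intro k hk
      have h := ncard_isGlued False (t := a + k + 1) (n := n) (a := a) (by omega) (by omega)
        (by omega) False.elim (fun _ => True)
      simp only [and_true, Set.ofPred_mem_eq] at h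
      rw [ncard_aCol] at h
      rw [← h]
      congr 1
      ext ⟨m, p⟩
      simp only [Set.mem_ofPred_eq, Prod.mk.injEq, decide_eq_true_eq, cutColor, if_false]
      constructor
      · rintro ⟨⟨hc, huv⟩, h1, h2⟩
        have hb := (IsDCol.isACol hc).bounds (i := a) (j := n - 1) le_rfl (by omega) (by omega)
        dsimp only at hb
        rcases IsDCol.isGlued_of_eq hc han huv with ⟨-, -, hg⟩ | ⟨-, -, hne, -⟩
        · dsimp only at hg
          rw [show p a (n - 1) = a + k by omega] at hg
          exact ⟨hc, hg⟩
        · exact absurd h2 hne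
      · rintro ⟨hc, hg⟩
        have h1 := hg.1 a (n - 1) le_rfl (by omega) (by omega) (by omega)
        have h2 := hg.1 a (a + k + 1) le_rfl (by omega) (by omega) (by omega)
        rw [crossColor, if_pos (by omega)] at h1 h2
        refine ⟨⟨hc, h1.1.trans h1.2.symm⟩, ?_⟩
        rw [h1.2, show a + k + 1 - 1 + 1 = a + k + 1 by omega, h2.2]
        omega
    have hIV : ∀ k < N, {c | c ∈ {c | c ∈ dCol a n ∧ c.1 a (n - 1) = c.2 a (n - 1)} ∧
        (c.2 a (c.2 a (n - 1) + 1) - a,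
          decide (c.2 a (c.2 a (n - 1) + 1) = c.2 a (n - 1))) = (k + 1, false)}.ncard =
        catalan (k + 1) * (dCol (a + k + 2) n).ncard := by
      intro k hk
      have h := ncard_isGlued True (t := a + (k + 1) + 1) (n := n) (a := a) (by omega) (by omega)
        (by omega) (fun _ => by omega) (fun _ => True)
      simp only [and_true, Set.ofPred_mem_eq] at h
      rw [ncard_aCol] at h
      rw [show a + k + 2 = a + (k + 1) + 1 by omega, ← h]
      congr 1
      ext ⟨m, p⟩
      simp only [Set.mem_ofPred_eq, Prod.mk.injEq, decide_eq_false_iff_not, cutColor, if_true]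
      constructor
      · rintro ⟨⟨hc, huv⟩, h1, h2⟩
        rcases IsDCol.isGlued_of_eq hc han huv with ⟨-, heq, -⟩ | ⟨-, -, hne, hg⟩
        · exact absurd heq h2
        · dsimp only at hg
          rw [show p a (p a (n - 1) + 1) = a + (k + 1) by omega] at hg
          exact ⟨hc, hg⟩
      · rintro ⟨hc, hg⟩
        have hb := (IsDCol.isACol hc).bounds (i := a) (j := a + (k + 1) + 1 - 1) le_rfl (by omega)
          (by omega)
        dsimp only at hb
        have h1 := hg.1 a (n - 1) le_rfl (by omega) (by omega) (by omega)
        generalize m a (a + (k + 1) + 1 - 1) = s at hg hb h1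
        rw [crossColor, if_pos (by omega)] at h1
        have h2 := hg.2 a (s + 1) le_rfl (by omega) (by omega) (by omega) (by omega)
        rw [crossColor, crossColor, if_pos (by omega), if_neg (by omega)] at h2
        refine ⟨⟨hc, h1.1.trans h1.2.symm⟩, ?_⟩
        rw [h1.2, h2]
        omega
    -- A block with one index admits only the first kind, so the term d_{n-1} appears once and not
    -- twice.
    have h0 : {c | c ∈ {c | c ∈ dCol a n ∧ c.1 a (n - 1) = c.2 a (n - 1)} ∧
        (c.2 a (c.2 a (n - 1) + 1) - a,
          decide (c.2 a (c.2 a (n - 1) + 1) = c.2 a (n - 1))) = (0, false)}.ncard = 0 := by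
      rw [show (0 : ℕ) = Set.ncard (∅ : Set ((ℕ → ℕ → ℕ) × (ℕ → ℕ → ℕ))) from
        Set.ncard_empty _ |>.symm]
      congr 1
      ext ⟨m, p⟩
      simp only [Set.mem_ofPred_eq, Prod.mk.injEq, decide_eq_false_iff_not, Set.mem_empty_iff_false,
        iff_false]
      rintro ⟨⟨hc, huv⟩, h1, h2⟩
      rcases IsDCol.isGlued_of_eq hc han huv with ⟨-, heq, -⟩ | ⟨h3, -, -, -⟩
      · exact h2 heq
      · dsimp only at h3
        simp only [Set.ncard_empty] at h1
        omega
    simp only [Fintype.sum_bool]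
    rw [Finset.sum_range_succ', hI 0 (by omega), h0, catalan_zero, one_mul, Finset.mul_sum]
    rw [add_zero, add_zero, add_comm]
    congr 1
    refine Finset.sum_congr rfl fun k hk => ?_
    rw [Finset.mem_range] at hk
    rw [hI (k + 1) (by omega), hIV k hk, show a + (k + 1) + 1 = a + k + 2 by omega]
    ring
  · rintro ⟨m, p⟩ ⟨hc, huv⟩
    simp only [Finset.mem_product, Finset.mem_range, Finset.mem_univ, and_true]
    have hb := (IsDCol.isACol hc).bounds (i := a) (j := n - 1) le_rfl (by omega) (by omega)
    rcases IsDCol.isGlued_of_eq hc han huv with ⟨h1, h2, -⟩ | ⟨-, h1, -, -⟩ <;>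
      dsimp only at * <;> omega

theorem ncard_dCol_recurrence (a N : ℕ) :
    (dCol a (a + N + 3)).ncard + 4 * catalan (N + 1) =
      (dCol (a + 1) (a + N + 3)).ncard +
        2 * ∑ k ∈ Finset.range N, catalan (k + 1) * (dCol (a + k + 2) (a + N + 3)).ncard +
        4 * catalan (N + 2) := by
  rw [← ncard_dCol_eq, ← ncard_dCol_ne, ← add_assoc]
  congr 1
  rw [← Set.ncard_union_eq ?_
    ((finite_dCol _ _).subset fun c hc => hc.1) ((finite_dCol _ _).subset fun c hc => hc.1)]
  · congr 1
    ext c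
    simp only [Set.mem_union, Set.mem_ofPred_eq]
    tauto
  · rw [Set.disjoint_left]
    exact fun c h h' => h'.2 h.2

theorem ncard_dCol_two (a : ℕ) : (dCol a (a + 2)).ncard = 1 := by
  rw [Set.ncard_eq_one]
  refine ⟨(fun i j => if i = a ∧ j = a + 1 then a else 0,
    fun i j => if i = a ∧ j = a + 1 ∨ i = a + 1 ∧ j = a then a + 1 else 0),
    Set.ext fun c => ⟨fun hc => ?_, ?_⟩⟩
  · obtain ⟨m, p⟩ := c
    replace hc : IsDCol a (a + 2) m p := hc
    have h1 := hc.isACol.simple a le_rfl (by omega)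
    have h2 := hc.simple (by omega)
    have h3 := hc.symm a (a + 1)
    rw [show a + 2 - 2 = a by omega, show a + 2 - 1 = a + 1 by omega] at h2
    refine Prod.ext ?_ ?_ <;> funext i j <;> dsimp only
    · split_ifs with h
      · rw [h.1, h.2, h1]
      · exact hc.isACol.supp i j (by omega)
    · split_ifs with h
      · rcases h with ⟨rfl, rfl⟩ | ⟨rfl, rfl⟩ <;> omega
      · exact hc.supp i j (by omega)
  · rintro rfl
    refine ⟨⟨fun i j hij => if_neg (by omega), fun i hi hib => ?_, fun i j k _ _ _ _ => by omega⟩,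
      fun i j hij => if_neg (by omega), fun i j => ?_, fun _ => if_pos (by omega),
      fun i j k _ _ _ _ _ _ _ => by omega⟩
    · dsimp only
      rw [if_pos (by omega)]
      omega
    · dsimp only
      split_ifs <;> omega

/-- The recurrence and the two-index case determine the count from the length of the index range, so
no relabelling bijection is needed. -/
theorem ncard_dCol_shift (N : ℕ) : ∀ a : ℕ,
    (dCol a (a + N + 2)).ncard = (dCol 0 (0 + N + 2)).ncard := by
  induction N using Nat.strong_induction_on with
  | _ N ih =>
    intro a
    rcases N with _ | N
    · rw [add_zero, add_zero, ncard_dCol_two, ncard_dCol_two]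
    · have h1 := ncard_dCol_recurrence a N
      have h2 := ncard_dCol_recurrence 0 N
      have h3 : ∀ b k, k < N + 1 → (dCol (b + k + 1) (b + N + 3)).ncard =
          (dCol 0 (0 + (N - k) + 2)).ncard := by
        intro b k hk
        rw [← ih (N - k) (by omega) (b + k + 1)]
        congr 2
        omega
      have h4 : ∀ b, ∑ k ∈ Finset.range N,
          catalan (k + 1) * (dCol (b + k + 2) (b + N + 3)).ncard =
          ∑ k ∈ Finset.range N, catalan (k + 1) * (dCol 0 (0 + (N - (k + 1)) + 2)).ncard := by
        intro b
        refine Finset.sum_congr rfl fun k hk => ?_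
        rw [Finset.mem_range] at hk
        rw [← h3 b (k + 1) (by omega)]
        rfl
      rw [h4, show a + 1 = a + 0 + 1 from rfl, h3 a 0 (by omega)] at h1
      rw [h4, show (0 : ℕ) + 1 = 0 + 0 + 1 from rfl, h3 0 0 (by omega)] at h2
      rw [show a + (N + 1) + 2 = a + N + 3 by omega, show 0 + (N + 1) + 2 = 0 + N + 3 by omega]
      omega

/-! ### Fine decompositions as colourings -/

section RootColoring

variable {V : Type*} [AddCommGroup V]

/-- Colourings of `P` by `r` simple elements `s i` such that the colour of a sum is the colour of a
summand. -/
structure IsRootColoring (P : Set V) (r : ℕ) (s : ℕ → V) (C : V → ℕ) : Prop where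
  supp : ∀ α, α ∉ P → C α = 0
  lt : ∀ α ∈ P, C α < r
  simple : ∀ i < r, C (s i) = i
  law : ∀ α ∈ P, ∀ β ∈ P, α + β ∈ P → C (α + β) = C α ∨ C (α + β) = C β

/-- The colour classes. -/
def colorClass (P : Set V) (C : V → ℕ) (l : ℕ) : Set V := {α | α ∈ P ∧ C α = l}

theorem IsRootColoring.isDecomposition {P : Set V} {r : ℕ} {s : ℕ → V} {C : V → ℕ}
    (hs : ∀ i < r, s i ∈ P) (h : IsRootColoring P r s C) :
    IsDecomposition P P (colorClass P C '' Set.Iio r) ∧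
      (colorClass P C '' Set.Iio r).encard = r := by
  refine ⟨⟨?_, ?_, ?_⟩, ?_⟩
  · rintro _ ⟨l, hl, rfl⟩
    refine ⟨⟨s l, hs l hl, h.simple l hl⟩, fun α hα => hα.1, ?_, ?_⟩
    · rintro α ⟨hα, hαl⟩ β ⟨hβ, hβl⟩ hαβ
      refine ⟨hαβ, ?_⟩
      rcases h.law α hα β hβ hαβ with h1 | h1 <;> rw [h1] <;> assumption
    · rintro α ⟨hα, hαl⟩ β ⟨hβ, hβl⟩ hαβ
      refine ⟨hαβ, fun hc => ?_⟩
      rcases h.law α hα β hβ hαβ with h1 | h1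
      · exact hαl ⟨hα, h1 ▸ hc.2⟩
      · exact hβl ⟨hβ, h1 ▸ hc.2⟩
  · rintro _ ⟨l, hl, rfl⟩ _ ⟨l', hl', rfl⟩ hne
    rw [Set.disjoint_left]
    rintro α ⟨-, h1⟩ ⟨-, h2⟩
    exact hne (by rw [← h1, ← h2])
  · ext α
    constructor
    · rintro ⟨_, ⟨l, hl, rfl⟩, hα⟩
      exact hα.1
    · intro hα
      exact ⟨_, ⟨C α, h.lt α hα, rfl⟩, hα, rfl⟩
  · rw [Set.InjOn.encard_image]
    · rw [← Finset.coe_range, Set.encard_coe_eq_coe_finsetCard, Finset.card_range]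
    · intro l hl l' hl' heq
      have : s l ∈ colorClass P C l' := heq ▸ ⟨hs l hl, h.simple l hl⟩
      exact (h.simple l hl).symm.trans this.2

/-- If the simple elements generate `P`, then every decomposition into the maximal number of parts
is the set of colour classes of a unique colouring. -/
theorem ncard_decompositions {P : Set V} {r : ℕ} {s : ℕ → V} (hs : ∀ i < r, s i ∈ P)
    (hgen : ∀ Q ⊆ P, (∀ i < r, s i ∈ Q) → (∀ α ∈ Q, ∀ β ∈ Q, α + β ∈ P → α + β ∈ Q) → P ⊆ Q) :
    {D | IsDecomposition P P D ∧ D.encard = r}.ncard = {C | IsRootColoring P r s C}.ncard := by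
  symm
  refine Set.BijOn.ncard_eq (f := fun C => colorClass P C '' Set.Iio r) ⟨?_, ?_, ?_⟩
  · intro C hC
    exact IsRootColoring.isDecomposition hs hC
  · intro C hC C' hC' heq
    replace hC : IsRootColoring P r s C := hC
    replace hC' : IsRootColoring P r s C' := hC'
    funext α
    by_cases hα : α ∈ P
    · have h1 : colorClass P C (C α) ∈ colorClass P C' '' Set.Iio r := by
        rw [← show colorClass P C '' Set.Iio r = colorClass P C' '' Set.Iio r from heq]
        exact ⟨_, hC.lt α hα, rfl⟩
      obtain ⟨l, hl, hl'⟩ := h1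
      have h2 : s (C α) ∈ colorClass P C' l := by
        rw [hl']
        exact ⟨hs _ (hC.lt α hα), hC.simple _ (hC.lt α hα)⟩
      have h3 : α ∈ colorClass P C' l := by
        rw [hl']
        exact ⟨hα, rfl⟩
      rw [h3.2, ← h2.2, hC'.simple _ (hC.lt α hα)]
    · rw [hC.supp α hα, hC'.supp α hα]
  · rintro D ⟨⟨hD, hdisj, hU⟩, hcard⟩
    have hpart : ∀ i, ∃ Ψ, i < r → Ψ ∈ D ∧ s i ∈ Ψ := by
      intro i
      by_cases hi : i < r
      · have := hs i hi
        rw [← hU] at this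
        obtain ⟨Ψ, h1, h2⟩ := this
        exact ⟨Ψ, fun _ => ⟨h1, h2⟩⟩
      · exact ⟨∅, fun h => absurd h hi⟩
    choose g hg using hpart
    have huniq : ∀ Ψ ∈ D, ∀ Ψ' ∈ D, ∀ α, α ∈ Ψ → α ∈ Ψ' → Ψ = Ψ' := by
      intro Ψ h1 Ψ' h2 α h3 h4
      by_contra hne
      exact Set.disjoint_left.1 (hdisj Ψ h1 Ψ' h2 hne) h3 h4
    have himg : g '' Set.Iio r = D := by
      ext Ψ
      constructor
      · rintro ⟨i, hi, rfl⟩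
        exact (hg i hi).1
      · intro hΨ
        by_contra hc
        obtain ⟨⟨α, hα⟩, hsub, -, hco⟩ := hD Ψ hΨ
        -- A part without simple elements has a closed complement containing all of them, hence
        -- equal to P, although the part is nonempty.
        refine (hgen (P \ Ψ) Set.sdiff_subset (fun i hi => ⟨hs i hi, fun hi' => hc ⟨i, hi, ?_⟩⟩)
          hco (hsub hα)).2 hα
        exact huniq _ (hg i hi).1 _ hΨ _ (hg i hi).2 hi'
    -- A surjection from r labels onto r parts is injective.
    have hinj : Set.InjOn g (Set.Iio r) := by
      refine Set.injOn_of_ncard_image_eq ?_ (Set.finite_Iio r)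
      rw [himg, Set.ncard_def, hcard, ← Finset.coe_range, Set.ncard_coe_finset]
      simp
    have hcol : ∀ α, ∃ i, (α ∈ P → i < r ∧ α ∈ g i) ∧ (α ∉ P → i = 0) := by
      intro α
      by_cases hα : α ∈ P
      · have h1 := hα
        rw [← hU] at h1
        obtain ⟨Ψ, h2, h3⟩ := h1
        rw [← himg] at h2
        obtain ⟨i, hi, rfl⟩ := h2
        exact ⟨i, fun _ => ⟨hi, h3⟩, fun h => absurd hα h⟩
      · exact ⟨0, fun h => absurd h hα, fun _ => rfl⟩
    choose C hC hC0 using hcol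
    have hCeq : ∀ α i, i < r → α ∈ g i → C α = i := by
      intro α i hi hα
      have hP := (hD _ (hg i hi).1).2.1 hα
      have := hC α hP
      exact hinj this.1 hi (huniq _ (hg _ this.1).1 _ (hg i hi).1 α this.2 hα)
    refine ⟨C, ⟨hC0, fun α hα => (hC α hα).1, fun i hi => hCeq _ _ hi (hg i hi).2, ?_⟩, ?_⟩
    · intro α hα β hβ hαβ
      by_contra hc
      push Not at hc
      have h1 := hC _ hαβ
      -- If neither summand lay in the part of α + β, co-closedness of that part would expel the
      -- sum.
      refine ((hD _ (hg _ h1.1).1).2.2.2 α ⟨hα, fun h => ?_⟩ β ⟨hβ, fun h => ?_⟩ hαβ).2 h1.2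
      · exact hc.1 (hCeq α _ h1.1 h).symm
      · exact hc.2 (hCeq β _ h1.1 h).symm
    · dsimp only
      rw [← himg]
      refine Set.image_congr fun i hi => ?_
      ext α
      constructor
      · rintro ⟨hα, rfl⟩
        exact (hC α hα).2
      · intro hα
        exact ⟨(hD _ (hg i hi).1).2.1 hα, hCeq α i hi hα⟩

end RootColoring

/-! ### Positive roots in integral coordinates -/

section Frame

variable {V : Type*} [AddCommGroup V] {n : ℕ} {B : ℕ → V}

/-- The positive roots `B i ± B j` (`i < j < n`). -/
def framePos (n : ℕ) (B : ℕ → V) : Set V :=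
  {α | ∃ i j, i < j ∧ j < n ∧ (α = B i - B j ∨ α = B i + B j)}

/-- The simple roots of `framePos`. -/
def frameSimple (n : ℕ) (B : ℕ → V) (i : ℕ) : V :=
  if i + 1 < n then B i - B (i + 1) else B (n - 2) + B (n - 1)

theorem add_mem_framePos {i j : ℕ} (hij : i ≠ j) (hi : i < n) (hj : j < n) :
    B i + B j ∈ framePos n B := by
  rcases lt_or_gt_of_ne hij with h | h
  · exact ⟨i, j, h, hj, Or.inr rfl⟩
  · exact ⟨j, i, h, hi, Or.inr (add_comm _ _)⟩

theorem sub_mem_framePos {i j : ℕ} (hij : i < j) (hj : j < n) : B i - B j ∈ framePos n B :=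
  ⟨i, j, hij, hj, Or.inl rfl⟩

theorem frameSimple_mem (hn : 2 ≤ n) {i : ℕ} (hi : i < n) : frameSimple n B i ∈ framePos n B := by
  unfold frameSimple
  split_ifs with h
  · exact sub_mem_framePos (by omega) h
  · exact add_mem_framePos (by omega) (by omega) (by omega)

/-- Each positive root is reached by adding simple roots one at a time within the positive roots:
first the differences, then the sums with B (n-1), then all sums. -/
theorem framePos_subset_of_closed (hn : 2 ≤ n) {Q : Set V} (hs : ∀ i < n, frameSimple n B i ∈ Q)
    (hQ : ∀ α ∈ Q, ∀ β ∈ Q, α + β ∈ framePos n B → α + β ∈ Q) : framePos n B ⊆ Q := by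
  have hsub : ∀ i j, i < j → j < n → B i - B j ∈ Q := by
    intro i j hij hj
    induction j, hij using Nat.le_induction with
    | base =>
      have := hs i (by omega)
      rwa [frameSimple, if_pos hj] at this
    | succ k hk ih =>
      have h1 := hs k (by omega)
      rw [frameSimple, if_pos hj] at h1
      have := hQ _ (ih (by omega)) _ h1
      rw [sub_add_sub_cancel] at this
      exact this (sub_mem_framePos (by omega) hj)
  have hlast : B (n - 2) + B (n - 1) ∈ Q := by
    have := hs (n - 1) (by omega)
    rwa [frameSimple, if_neg (by omega)] at this
  have hadd1 : ∀ i, i < n - 1 → B i + B (n - 1) ∈ Q := by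
    intro i hi
    by_cases h : i = n - 2
    · rwa [h]
    · have := hQ _ (hsub i (n - 2) (by omega) (by omega)) _ hlast
      rw [show ∀ x y z : V, x - y + (y + z) = x + z by intros; abel] at this
      exact this (add_mem_framePos (by omega) (by omega) (by omega))
  have hadd : ∀ i j, i < j → j < n → B i + B j ∈ Q := by
    intro i j hij hj
    by_cases h : j = n - 1
    · rw [h]
      exact hadd1 i (by omega)
    · have := hQ _ (hadd1 i (by omega)) _ (hsub j (n - 1) (by omega) (by omega))
      rw [add_add_sub_cancel] at this
      exact this (add_mem_framePos (by omega) (by omega) (by omega))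
  rintro α ⟨i, j, hij, hj, rfl | rfl⟩
  · exact hsub i j hij hj
  · exact hadd i j hij hj

open Classical in
/-- The colouring of `framePos` given by colours of differences and sums. -/
noncomputable def frameColor (n : ℕ) (B : ℕ → V) (m p : ℕ → ℕ → ℕ) (α : V) : ℕ :=
  if h : ∃ c : ℕ × ℕ, c.1 < c.2 ∧ c.2 < n ∧ α = B c.1 - B c.2 then m h.choose.1 h.choose.2
  else if h : ∃ c : ℕ × ℕ, c.1 < c.2 ∧ c.2 < n ∧ α = B c.1 + B c.2 then p h.choose.1 h.choose.2
  else 0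

theorem frameColor_of_notMem (m p : ℕ → ℕ → ℕ) {α : V} (hα : α ∉ framePos n B) :
    frameColor n B m p α = 0 := by
  rw [frameColor, dif_neg, dif_neg]
  · rintro ⟨c, h1, h2, h3⟩
    exact hα ⟨c.1, c.2, h1, h2, Or.inr h3⟩
  · rintro ⟨c, h1, h2, h3⟩
    exact hα ⟨c.1, c.2, h1, h2, Or.inl h3⟩

theorem IsRootColoring.isDCol {C : V → ℕ} (hn : 2 ≤ n)
    (hC : IsRootColoring (framePos n B) n (frameSimple n B) C) :
    IsDCol 0 n (fun i j => if i < j ∧ j < n then C (B i - B j) else 0)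
      (fun i j => if i ≠ j ∧ i < n ∧ j < n then C (B i + B j) else 0) := by
  refine ⟨⟨fun i j hij => if_neg (by omega), fun i _ hi => ?_, fun i j k _ hij hjk hk => ?_⟩,
    fun i j hij => if_neg (by omega), fun i j => ?_, fun _ => ?_,
    fun i j k _ _ hij hki hkj hj hk => ?_⟩
  · rw [if_pos (by omega)]
    have := hC.simple i (by omega)
    rwa [frameSimple, if_pos hi] at this
  · rw [if_pos (by omega), if_pos (by omega), if_pos (by omega)]
    have := hC.law _ (sub_mem_framePos hij (hjk.trans hk)) _ (sub_mem_framePos hjk hk)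
    rw [sub_add_sub_cancel] at this
    exact this (sub_mem_framePos (hij.trans hjk) hk)
  · rw [add_comm]
    split_ifs <;> first | rfl | omega
  · rw [if_pos (by omega)]
    have := hC.simple (n - 1) (by omega)
    rwa [frameSimple, if_neg (by omega)] at this
  · rw [if_pos (by omega), if_pos (by omega), if_pos (by omega)]
    have := hC.law _ (sub_mem_framePos hij hj) _ (add_mem_framePos hkj.symm hj hk)
    rw [show ∀ x y z : V, x - y + (y + z) = x + z by intros; abel] at this
    exact this (add_mem_framePos hki.symm (by omega) hk)

variable [Module ℝ V]

/-- `B 0, …, B (n - 1)` have integral dual coordinates `φ`. -/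
def IsFrame (n : ℕ) (B : ℕ → V) (φ : V →ₗ[ℝ] ℕ → ℝ) : Prop :=
  ∀ i < n, ∀ q, φ (B i) q = ((if i = q then 1 else 0 : ℤ) : ℝ)

variable {φ : V →ₗ[ℝ] ℕ → ℝ}

theorem IsFrame.sum (h : IsFrame n B φ) {i : ℕ} (hi : i < n) :
    ∑ q ∈ Finset.range n, φ (B i) q = 1 := by
  rw [Finset.sum_congr rfl fun q _ => h i hi q]
  simp [hi]

/-- The sum of the coordinates. -/
theorem IsFrame.exists_height (h : IsFrame n B φ) : ∃ ψ : V →ₗ[ℝ] ℝ, ∀ i < n, ψ (B i) = 1 :=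
  ⟨∑ q ∈ Finset.range n, (LinearMap.proj q).comp φ, fun i hi => by simpa using h.sum hi⟩

theorem IsFrame.sub_ne_add (h : IsFrame n B φ) {i j k l : ℕ} (hi : i < n) (hj : j < n) (hk : k < n)
    (hl : l < n) : B i - B j ≠ B k + B l := by
  obtain ⟨ψ, hψ⟩ := h.exists_height
  intro heq
  have := congrArg ψ heq
  rw [map_sub, map_add, hψ i hi, hψ j hj, hψ k hk, hψ l hl] at this
  norm_num at this

theorem IsFrame.sub_inj (h : IsFrame n B φ) {i j k l : ℕ} (hij : i < j) (hj : j < n) (hkl : k < l)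
    (hl : l < n) (heq : B i - B j = B k - B l) : i = k ∧ j = l := by
  have h1 : ∀ q, ((if i = q then 1 else 0 : ℤ) - (if j = q then 1 else 0)) =
      (if k = q then 1 else 0) - (if l = q then 1 else 0) := by
    intro q
    have := congrFun (congrArg φ heq) q
    simp only [map_sub, Pi.sub_apply] at this
    rw [h i (by omega), h j hj, h k (by omega), h l hl] at this
    exact_mod_cast this
  have h2 := h1 i
  have h3 := h1 j
  split_ifs at h2 h3 <;> omega

theorem IsFrame.add_inj (h : IsFrame n B φ) {i j k l : ℕ} (hij : i < j) (hj : j < n) (hkl : k < l)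
    (hl : l < n) (heq : B i + B j = B k + B l) : i = k ∧ j = l := by
  have h1 : ∀ q, ((if i = q then 1 else 0 : ℤ) + (if j = q then 1 else 0)) =
      (if k = q then 1 else 0) + (if l = q then 1 else 0) := by
    intro q
    have := congrFun (congrArg φ heq) q
    simp only [map_add, Pi.add_apply] at this
    rw [h i (by omega), h j hj, h k (by omega), h l hl] at this
    exact_mod_cast this
  have h2 := h1 i
  have h3 := h1 j
  split_ifs at h2 h3 <;> omega

/-- Compare coordinates at i, j, k and l. This and `IsFrame.sub_add_add` show that the laws of
`IsDCol` cover all additive relations among positive roots; the other sign patterns are excluded by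
the sum of coordinates, which is 0 on differences and 2 on sums. -/
theorem IsFrame.sub_add_sub (h : IsFrame n B φ) {i j k l x y : ℕ} (hij : i < j) (hj : j < n)
    (hkl : k < l) (hl : l < n) (hxy : x < y) (hy : y < n)
    (heq : B i - B j + (B k - B l) = B x - B y) :
    j = k ∧ x = i ∧ y = l ∨ i = l ∧ x = k ∧ y = j := by
  have h1 : ∀ q, ((if i = q then 1 else 0 : ℤ) - (if j = q then 1 else 0)) +
      ((if k = q then 1 else 0) - (if l = q then 1 else 0)) =
      (if x = q then 1 else 0) - (if y = q then 1 else 0) := by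
    intro q
    have := congrFun (congrArg φ heq) q
    simp only [map_sub, map_add, Pi.sub_apply, Pi.add_apply] at this
    rw [h i (by omega), h j hj, h k (by omega), h l hl, h x (by omega), h y hy] at this
    exact_mod_cast this
  have hi := h1 i
  have hj := h1 j
  have hk := h1 k
  have hl := h1 l
  clear h1 heq
  grind (splits := 30)

theorem IsFrame.sub_add_add (h : IsFrame n B φ) {i j k l x y : ℕ} (hij : i < j) (hj : j < n)
    (hkl : k < l) (hl : l < n) (hxy : x < y) (hy : y < n)
    (heq : B i - B j + (B k + B l) = B x + B y) :
    (j = k ∧ (x = i ∧ y = l ∨ x = l ∧ y = i)) ∨ (j = l ∧ (x = i ∧ y = k ∨ x = k ∧ y = i)) := by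
  have h1 : ∀ q, ((if i = q then 1 else 0 : ℤ) - (if j = q then 1 else 0)) +
      ((if k = q then 1 else 0) + (if l = q then 1 else 0)) =
      (if x = q then 1 else 0) + (if y = q then 1 else 0) := by
    intro q
    have := congrFun (congrArg φ heq) q
    simp only [map_sub, map_add, Pi.sub_apply, Pi.add_apply] at this
    rw [h i (by omega), h j hj, h k (by omega), h l hl, h x (by omega), h y hy] at this
    exact_mod_cast this
  have hi := h1 i
  have hj := h1 j
  have hk := h1 k
  have hl := h1 l
  clear h1 heq
  grind (splits := 30)

theorem frameColor_sub (h : IsFrame n B φ) (m p : ℕ → ℕ → ℕ) {i j : ℕ} (hij : i < j) (hj : j < n) :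
    frameColor n B m p (B i - B j) = m i j := by
  have hex : ∃ c : ℕ × ℕ, c.1 < c.2 ∧ c.2 < n ∧ B i - B j = B c.1 - B c.2 := ⟨(i, j), hij, hj, rfl⟩
  rw [frameColor, dif_pos hex]
  obtain ⟨h1, h2, h3⟩ := hex.choose_spec
  obtain ⟨h4, h5⟩ := h.sub_inj hij hj h1 h2 h3
  rw [← h4, ← h5]

theorem frameColor_add (h : IsFrame n B φ) (m : ℕ → ℕ → ℕ) {p : ℕ → ℕ → ℕ}
    (hp : ∀ i j, p i j = p j i) {i j : ℕ} (hij : i ≠ j) (hi : i < n) (hj : j < n) :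
    frameColor n B m p (B i + B j) = p i j := by
  wlog hlt : i < j generalizing i j
  · rw [add_comm, hp]
    exact this hij.symm hj hi (by omega)
  have hex : ∃ c : ℕ × ℕ, c.1 < c.2 ∧ c.2 < n ∧ B i + B j = B c.1 + B c.2 := ⟨(i, j), hlt, hj, rfl⟩
  rw [frameColor, dif_neg, dif_pos hex]
  · obtain ⟨h1, h2, h3⟩ := hex.choose_spec
    obtain ⟨h4, h5⟩ := h.add_inj hlt hj h1 h2 h3
    rw [← h4, ← h5]
  · rintro ⟨c, h1, h2, h3⟩
    exact h.sub_ne_add (h1.trans h2) h2 hi hj h3.symm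

theorem isRootColoring_frameColor (h : IsFrame n B φ) (hn : 2 ≤ n) {m p : ℕ → ℕ → ℕ}
    (hc : IsDCol 0 n m p) :
    IsRootColoring (framePos n B) n (frameSimple n B) (frameColor n B m p) where
  supp α hα := frameColor_of_notMem m p hα
  lt := by
    rintro α ⟨i, j, hij, hj, rfl | rfl⟩
    · rw [frameColor_sub h m p hij hj]
      have := hc.isACol.bounds (Nat.zero_le i) hij hj
      omega
    · rw [frameColor_add h m hc.symm hij.ne (hij.trans hj) hj]
      exact hc.plus_lt (Nat.zero_le i) (Nat.zero_le j) hij.ne (hij.trans hj) hj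
  simple i hi := by
    unfold frameSimple
    split_ifs with h1
    · rw [frameColor_sub h m p (by omega) h1]
      exact hc.isACol.simple i (Nat.zero_le i) h1
    · rw [frameColor_add h m hc.symm (by omega) (by omega) (by omega), hc.simple (by omega)]
      omega
  law := by
    obtain ⟨ψ, hψ⟩ := h.exists_height
    have hmix : ∀ i j k l x y, i < j → j < n → k < l → l < n → x < y → y < n →
        B i - B j + (B k + B l) = B x + B y → p x y = m i j ∨ p x y = p k l := by
      intro i j k l x y hij hj hkl hl hxy hy heq
      rcases h.sub_add_add hij hj hkl hl hxy hy heq with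
        ⟨rfl, ⟨rfl, rfl⟩ | ⟨rfl, rfl⟩⟩ | ⟨rfl, ⟨rfl, rfl⟩ | ⟨rfl, rfl⟩⟩
      · exact hc.law _ _ _ (by omega) (by omega) hij (by omega) (by omega) hj (by omega)
      · rw [hc.symm x y]
        exact hc.law _ _ _ (by omega) (by omega) hij (by omega) (by omega) hj (by omega)
      · rw [hc.symm y j]
        exact hc.law _ _ _ (by omega) (by omega) hij (by omega) (by omega) hj (by omega)
      · rw [hc.symm x y, hc.symm x j]
        exact hc.law _ _ _ (by omega) (by omega) hij (by omega) (by omega) hj (by omega)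
    rintro α ⟨i, j, hij, hj, hα⟩ β ⟨k, l, hkl, hl, hβ⟩ ⟨x, y, hxy, hy, hγ⟩
    rcases hγ with hγ | hγ <;> rw [hγ] <;> rcases hα with rfl | rfl <;> rcases hβ with rfl | rfl
    · rw [frameColor_sub h m p hij hj, frameColor_sub h m p hkl hl, frameColor_sub h m p hxy hy]
      rcases h.sub_add_sub hij hj hkl hl hxy hy hγ with ⟨rfl, rfl, rfl⟩ | ⟨rfl, rfl, rfl⟩
      · exact hc.isACol.law _ _ _ (by omega) hij hkl hl
      · exact (hc.isACol.law _ _ _ (by omega) hkl hij hj).symm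
    iterate 3
      exfalso
      have := congrArg ψ hγ
      simp only [map_sub, map_add, hψ i (by omega), hψ j hj, hψ k (by omega), hψ l hl,
        hψ x (by omega), hψ y hy] at this
      norm_num at this
    · exfalso
      have := congrArg ψ hγ
      simp only [map_sub, map_add, hψ i (by omega), hψ j hj, hψ k (by omega), hψ l hl,
        hψ x (by omega), hψ y hy] at this
      norm_num at this
    · rw [frameColor_sub h m p hij hj, frameColor_add h m hc.symm hkl.ne (hkl.trans hl) hl,
        frameColor_add h m hc.symm hxy.ne (hxy.trans hy) hy]
      exact hmix i j k l x y hij hj hkl hl hxy hy hγ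
    · rw [frameColor_sub h m p hkl hl, frameColor_add h m hc.symm hij.ne (hij.trans hj) hj,
        frameColor_add h m hc.symm hxy.ne (hxy.trans hy) hy]
      rw [add_comm] at hγ
      exact (hmix k l i j x y hkl hl hij hj hxy hy hγ).symm
    · exfalso
      have := congrArg ψ hγ
      simp only [map_add, hψ i (by omega), hψ j hj, hψ k (by omega), hψ l hl,
        hψ x (by omega), hψ y hy] at this
      norm_num at this

theorem IsFrame.ncard_isRootColoring (h : IsFrame n B φ) (hn : 2 ≤ n) :
    {C | IsRootColoring (framePos n B) n (frameSimple n B) C}.ncard = (dCol 0 n).ncard := by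
  refine Set.BijOn.ncard_eq (f := fun C =>
    (fun i j => if i < j ∧ j < n then C (B i - B j) else 0,
      fun i j => if i ≠ j ∧ i < n ∧ j < n then C (B i + B j) else 0)) ⟨?_, ?_, ?_⟩
  · intro C hC
    exact IsRootColoring.isDCol hn hC
  · intro C hC C' hC' heq
    simp only [Prod.mk.injEq] at heq
    funext α
    by_cases hα : α ∈ framePos n B
    · obtain ⟨i, j, hij, hj, rfl | rfl⟩ := hα
      · have := congrFun (congrFun heq.1 i) j
        rwa [if_pos (by omega), if_pos (by omega)] at this
      · have := congrFun (congrFun heq.2 i) j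
        rwa [if_pos (by omega), if_pos (by omega)] at this
    · rw [IsRootColoring.supp hC α hα, IsRootColoring.supp hC' α hα]
  · rintro ⟨m, p⟩ hc
    replace hc : IsDCol 0 n m p := hc
    refine ⟨frameColor n B m p, isRootColoring_frameColor h hn hc, ?_⟩
    refine Prod.ext ?_ ?_ <;> funext i j <;> dsimp only
    · split_ifs with hij
      · exact frameColor_sub h m p hij.1 hij.2
      · exact (hc.isACol.supp i j (by omega)).symm
    · split_ifs with hij
      · exact frameColor_add h m hc.symm hij.1 hij.2.1 hij.2.2
      · exact (hc.supp i j (by omega)).symm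

theorem IsFrame.ncard_decompositions (h : IsFrame n B φ) (hn : 2 ≤ n) :
    {D | IsDecomposition (framePos n B) (framePos n B) D ∧ D.encard = n}.ncard =
      (dCol 0 n).ncard := by
  rw [_root_.ncard_decompositions (s := frameSimple n B) (fun i hi => frameSimple_mem hn hi)
    (fun Q _ hs hQ => framePos_subset_of_closed hn hs hQ), h.ncard_isRootColoring hn]

end Frame

/-! ### Arbitrary bases of D_n -/

/-- Take the functional with value 1 on every element of the base: it is positive on nonzero sums of
base elements. -/
theorem exists_pos_functional {V : Type*} [AddCommGroup V] [Module ℝ V] {R S : Set V}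
    (h : IsRootBase R S) (h0 : (0 : V) ∉ R) :
    ∃ f : V →ₗ[ℝ] ℝ, (∀ α ∈ R, f α ≠ 0) ∧ posRoots R S = {α | α ∈ R ∧ 0 < f α} := by
  obtain ⟨-, hind, hspan, hpm⟩ := h
  obtain ⟨b, hb⟩ : ∃ b : Module.Basis S ℝ V, ∀ x : S, b x = x := by
    have hli : LinearIndependent ℝ (fun x : S => (x : V)) := hind
    exact ⟨Module.Basis.mk hli (by simpa using hspan.ge), fun x => Module.Basis.mk_apply _ _ x⟩
  obtain ⟨f, hf⟩ : ∃ f : V →ₗ[ℝ] ℝ, ∀ x ∈ S, f x = 1 := by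
    refine ⟨b.constr ℝ (fun _ => (1 : ℝ)), fun x hx => ?_⟩
    have := b.constr_basis ℝ (fun _ => (1 : ℝ)) ⟨x, hx⟩
    rwa [hb] at this
  have hpos : ∀ v ∈ AddSubmonoid.closure S, v = 0 ∨ 0 < f v := by
    intro v hv
    induction hv using AddSubmonoid.closure_induction with
    | mem x hx =>
      right
      rw [hf x hx]
      exact one_pos
    | zero => exact Or.inl rfl
    | add x y _ _ hx hy =>
      rcases hx with rfl | hx
      · rwa [zero_add]
      · rcases hy with rfl | hy
        · rw [add_zero]
          exact Or.inr hx
        · rw [map_add]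
          exact Or.inr (add_pos hx hy)
  have hne : ∀ α ∈ R, α ≠ 0 := by
    rintro α hα rfl
    exact h0 hα
  have hneg : ∀ α ∈ R, -α ∈ AddSubmonoid.closure S → f α < 0 := by
    intro α hα h1
    rcases hpos _ h1 with h2 | h2
    · exact absurd (neg_eq_zero.1 h2) (hne α hα)
    · rw [map_neg] at h2
      linarith
  refine ⟨f, fun α hα => ?_, ?_⟩
  · rcases hpm α hα with h1 | h1
    · rcases hpos α h1 with h2 | h2
      · exact absurd h2 (hne α hα)
      · exact h2.ne'
    · exact (hneg α hα h1).ne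
  · ext α
    constructor
    · rintro ⟨hα, h1⟩
      exact ⟨hα, (hpos α h1).resolve_left (hne α hα)⟩
    · rintro ⟨hα, h1⟩
      refine ⟨hα, (hpm α hα).resolve_right fun h2 => ?_⟩
      have := hneg α hα h2
      linarith

theorem mem_rootsD_iff {n : ℕ} (hn : 2 ≤ n) {v : Fin n → ℝ} :
    v ∈ rootsD n ↔ ∃ i j : Fin n, i ≠ j ∧ ∃ x y : ℝ, (x = 1 ∨ x = -1) ∧ (y = 1 ∨ y = -1) ∧
      v = x • stdVec i + y • stdVec j := by
  constructor
  · rintro (⟨i, j, hij, rfl | rfl | rfl⟩ | ⟨h, -⟩)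
    · exact ⟨i, j, hij, 1, 1, by simp, by simp, by module⟩
    · exact ⟨i, j, hij, 1, -1, by simp, by simp, by module⟩
    · exact ⟨i, j, hij, -1, -1, by simp, by simp, by module⟩
    · omega
  · rintro ⟨i, j, hij, x, y, rfl | rfl, rfl | rfl, rfl⟩
    · exact Or.inl ⟨i, j, hij, Or.inl (by module)⟩
    · exact Or.inl ⟨i, j, hij, Or.inr (Or.inl (by module))⟩
    · exact Or.inl ⟨j, i, hij.symm, Or.inr (Or.inl (by module))⟩
    · exact Or.inl ⟨i, j, hij, Or.inr (Or.inr (by module))⟩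

theorem zero_notMem_rootsD {n : ℕ} (hn : 2 ≤ n) : (0 : Fin n → ℝ) ∉ rootsD n := by
  rw [mem_rootsD_iff hn]
  rintro ⟨i, j, hij, x, y, hx, -, h⟩
  have := congrFun h i
  simp only [Pi.zero_apply, Pi.add_apply, Pi.smul_apply, stdVec, Pi.single_eq_same,
    Pi.single_eq_of_ne hij, smul_eq_mul, mul_one, mul_zero, add_zero] at this
  rcases hx with rfl | rfl <;> norm_num at this

/-- The positive roots of `D_n` for any base are `B i ± B j` for a signed permutation `B` of the
standard basis. -/
theorem exists_frame {n : ℕ} (hn : 2 ≤ n) {S : Set (Fin n → ℝ)} (hS : IsRootBase (rootsD n) S) :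
    ∃ (B : ℕ → Fin n → ℝ) (φ : (Fin n → ℝ) →ₗ[ℝ] ℕ → ℝ), IsFrame n B φ ∧
      posRoots (rootsD n) S = framePos n B := by
  obtain ⟨f, hf, hP⟩ := exists_pos_functional hS (zero_notMem_rootsD hn)
  -- Sort the basis vectors by decreasing |f|. The values are distinct because f does not vanish on
  -- the roots e_i ± e_j.
  obtain ⟨σ, hσ⟩ : ∃ σ : Equiv.Perm (Fin n), ∀ i j, i < j →
      |f (stdVec (σ j))| < |f (stdVec (σ i))| := by
    refine ⟨Tuple.sort fun i => -|f (stdVec i)|, fun i j hij => ?_⟩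
    have h1 := Tuple.monotone_sort (fun i => -|f (stdVec i)|) hij.le
    simp only [Function.comp_apply, neg_le_neg_iff] at h1
    generalize Tuple.sort (fun i => -|f (stdVec i)|) = σ at h1 ⊢
    refine lt_of_le_of_ne h1 fun h2 => ?_
    have hne : σ i ≠ σ j := fun h => hij.ne (σ.injective h)
    rcases abs_eq_abs.1 h2 with h3 | h3
    · refine hf (stdVec (σ i) - stdVec (σ j)) (Or.inl ⟨_, _, hne, Or.inr (Or.inl rfl)⟩) ?_
      rw [map_sub, h3, sub_self]
    · refine hf (stdVec (σ i) + stdVec (σ j)) (Or.inl ⟨_, _, hne, Or.inl rfl⟩) ?_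
      rw [map_add, h3, add_neg_cancel]
  -- The signs make f nonnegative on each B i. The last value may be zero, and its sign is then
  -- irrelevant to positivity.
  obtain ⟨ε, hε, hεf⟩ : ∃ ε : Fin n → ℝ, (∀ i, ε i = 1 ∨ ε i = -1) ∧
      ∀ i, ε i * f (stdVec (σ i)) = |f (stdVec (σ i))| := by
    refine ⟨fun i => if 0 ≤ f (stdVec (σ i)) then 1 else -1, fun i => ?_, fun i => ?_⟩
    · dsimp only
      split_ifs <;> simp
    · dsimp only
      split_ifs with h
      · rw [abs_of_nonneg h, one_mul]
      · rw [abs_of_neg (not_le.1 h), neg_one_mul]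
  have hεsq : ∀ i, ε i * ε i = 1 := by
    intro i
    rcases hε i with h | h <;> rw [h] <;> norm_num
  obtain ⟨B, hB⟩ : ∃ B : ℕ → Fin n → ℝ, ∀ i : Fin n, B i = ε i • stdVec (σ i) :=
    ⟨fun i => if h : i < n then ε ⟨i, h⟩ • stdVec (σ ⟨i, h⟩) else 0, fun i => by simp⟩
  have hfB : ∀ i : Fin n, f (B i) = |f (stdVec (σ i))| := by
    intro i
    rw [hB, map_smul, smul_eq_mul, hεf]
  have hroot : ∀ i j : Fin n, i ≠ j → ∀ x y : ℝ, (x = 1 ∨ x = -1) → (y = 1 ∨ y = -1) →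
      x • B i + y • B j ∈ rootsD n := by
    intro i j hij x y hx hy
    rw [mem_rootsD_iff hn]
    refine ⟨σ i, σ j, fun h => hij (σ.injective h), x * ε i, y * ε j, ?_, ?_, ?_⟩
    · rcases hx with rfl | rfl <;> rcases hε i with h | h <;> rw [h] <;> norm_num
    · rcases hy with rfl | rfl <;> rcases hε j with h | h <;> rw [h] <;> norm_num
    · rw [hB, hB, smul_smul, smul_smul]
  refine ⟨B, LinearMap.pi fun q => if h : q < n then ε ⟨q, h⟩ • LinearMap.proj (σ ⟨q, h⟩) else 0,
    ?_, ?_⟩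
  · intro i hi q
    rw [LinearMap.pi_apply, show B i = B (⟨i, hi⟩ : Fin n) from rfl, hB]
    by_cases hq : q < n
    · rw [dif_pos hq]
      by_cases hiq : i = q
      · subst hiq
        simp [stdVec, hεsq]
      · have : σ ⟨q, hq⟩ ≠ σ ⟨i, hi⟩ := fun h => hiq (Fin.mk.inj (σ.injective h)).symm
        simp [stdVec, hiq, this]
    · rw [dif_neg hq, if_neg (by omega)]
      simp
  · rw [hP]
    ext α
    constructor
    · rintro ⟨hα, hpos⟩
      rw [mem_rootsD_iff hn] at hα
      obtain ⟨k, l, hkl, x, y, hx, hy, rfl⟩ := hα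
      obtain ⟨i, rfl⟩ := σ.surjective k
      obtain ⟨j, rfl⟩ := σ.surjective l
      have hij : i ≠ j := fun h => hkl (h ▸ rfl)
      have hst : ∀ i, stdVec (σ i) = ε i • B i := by
        intro i
        rw [hB, smul_smul, hεsq, one_smul]
      have key : ∀ i j : Fin n, i < j → ∀ x y : ℝ, (x = 1 ∨ x = -1) → (y = 1 ∨ y = -1) →
          0 < f (x • B i + y • B j) → x • B i + y • B j ∈ framePos n B := by
        intro i j hij x y hx hy h
        have h1 := hσ i j hij
        rw [map_add, map_smul, map_smul, hfB, hfB, smul_eq_mul, smul_eq_mul] at h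
        have h2 := abs_nonneg (f (stdVec (σ j)))
        rcases hx with rfl | rfl
        · refine ⟨i, j, hij, j.2, ?_⟩
          rcases hy with rfl | rfl
          · right
            module
          · left
            module
        · exfalso
          rcases hy with rfl | rfl <;> linarith
      have hx' : x * ε i = 1 ∨ x * ε i = -1 := by
        rcases hx with rfl | rfl <;> rcases hε i with h | h <;> rw [h] <;> norm_num
      have hy' : y * ε j = 1 ∨ y * ε j = -1 := by
        rcases hy with rfl | rfl <;> rcases hε j with h | h <;> rw [h] <;> norm_num
      rw [hst, hst, smul_smul, smul_smul] at hpos ⊢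
      rcases lt_or_gt_of_ne hij with h | h
      · exact key i j h _ _ hx' hy' hpos
      · rw [add_comm] at hpos ⊢
        exact key j i h _ _ hy' hx' hpos
    · rintro ⟨i, j, hij, hj, h⟩
      have hi : i < n := hij.trans hj
      have h1 := hσ ⟨i, hi⟩ ⟨j, hj⟩ hij
      have h2 := hfB ⟨i, hi⟩
      have h3 := hfB ⟨j, hj⟩
      have h4 := abs_nonneg (f (stdVec (σ ⟨j, hj⟩)))
      have hne : (⟨i, hi⟩ : Fin n) ≠ ⟨j, hj⟩ := fun h => hij.ne (Fin.mk.inj h)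
      rcases h with rfl | rfl
      · have h5 := hroot _ _ hne 1 (-1) (by simp) (by simp)
        refine ⟨?_, ?_⟩
        · convert h5 using 1
          module
        · rw [map_sub]
          dsimp only at h2 h3
          linarith
      · have h5 := hroot _ _ hne 1 1 (by simp) (by simp)
        refine ⟨?_, ?_⟩
        · convert h5 using 1
          module
        · rw [map_add]
          dsimp only at h2 h3
          linarith

/-! ### The numbers d_n -/

theorem numFineDecompositions_rootsD {n : ℕ} (hn : 2 ≤ n) {S : Set (Fin n → ℝ)}
    (hS : IsRootBase (rootsD n) S) : numFineDecompositions (rootsD n) S = (dCol 0 n).ncard := by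
  obtain ⟨B, φ, h, hP⟩ := exists_frame hn hS
  rw [← h.ncard_decompositions hn, numFineDecompositions]
  congr 1
  ext D
  simp only [Set.mem_ofPred_eq, IsFineDecomposition, hP, Module.finrank_fin_fun]

theorem numFineDecompositions_rootsD_zero (S : Set (Fin 0 → ℝ)) :
    numFineDecompositions (rootsD 0) S = 1 := by
  have hP : posRoots (rootsD 0) S = ∅ := by
    rw [Set.eq_empty_iff_forall_notMem]
    rintro α ⟨⟨i, -⟩ | ⟨h, -⟩, -⟩
    · exact i.elim0
    · omega
  rw [numFineDecompositions, Set.ncard_eq_one]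
  refine ⟨∅, ?_⟩
  ext D
  simp only [Set.mem_ofPred_eq, IsFineDecomposition, hP, Module.finrank_fin_fun, Nat.cast_zero,
    Set.encard_eq_zero, Set.mem_singleton_iff, and_iff_right_iff_imp]
  rintro rfl
  simp [IsDecomposition]

theorem numFineDecompositions_rootsD_one {S : Set (Fin 1 → ℝ)} (hS : IsRootBase (rootsD 1) S) :
    numFineDecompositions (rootsD 1) S = 1 := by
  obtain ⟨α, hα⟩ : (posRoots (rootsD 1) S).Nonempty := by
    have hne : S.Nonempty := by
      rw [Set.nonempty_iff_ne_empty]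
      rintro rfl
      have := hS.2.2.1
      rw [Submodule.span_empty] at this
      exact bot_ne_top this
    obtain ⟨x, hx⟩ := hne
    exact ⟨x, hS.1 hx, AddSubmonoid.subset_closure hx⟩
  rw [numFineDecompositions, Set.ncard_eq_one]
  refine ⟨{posRoots (rootsD 1) S}, ?_⟩
  ext D
  simp only [Set.mem_ofPred_eq, IsFineDecomposition, Module.finrank_fin_fun, Nat.cast_one,
    Set.mem_singleton_iff]
  constructor
  · rintro ⟨⟨-, -, hU⟩, hcard⟩
    obtain ⟨Ψ, rfl⟩ := Set.encard_eq_one.1 hcard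
    rw [← hU, Set.sUnion_singleton]
  · rintro rfl
    refine ⟨⟨?_, ?_, Set.sUnion_singleton _⟩, Set.encard_singleton _⟩
    · rintro _ rfl
      exact ⟨⟨α, hα⟩, subset_rfl, fun _ _ _ _ h => h, fun x hx => absurd hx.1 hx.2⟩
    · rintro _ rfl _ rfl h
      exact absurd rfl h

theorem mainTheorem9 (S : (n : ℕ) → Set (Fin n → ℝ)) (hS : ∀ n, IsRootBase (rootsD n) (S n))
    (d : ℕ → ℕ) (hd : ∀ n, d n = numFineDecompositions (rootsD n) (S n)) :
    (d 0 = 1 ∧ d 1 = 1 ∧ d 2 = 1 ∧ d 3 = 5 ∧ d 4 = 19 ∧ d 5 = 69 ∧ d 6 = 249) ∧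
    ∀ n : ℕ, 3 ≤ n →
      (d n : ℤ) = d (n - 1) + 2 * ∑ i ∈ Finset.range (n - 1), (catalan (i + 1) : ℤ) * d (n - i - 2)
        + 2 * catalan (n - 1) - 6 * catalan (n - 2) := by
  have h0 : d 0 = 1 := by rw [hd, numFineDecompositions_rootsD_zero]
  have h1 : d 1 = 1 := by rw [hd, numFineDecompositions_rootsD_one (hS 1)]
  have hcol : ∀ a N, (dCol a (a + N + 2)).ncard = d (N + 2) := by
    intro a N
    rw [ncard_dCol_shift, hd, numFineDecompositions_rootsD (by omega) (hS _), zero_add]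
  have h2 : d 2 = 1 := by rw [← hcol 0 0, zero_add, zero_add, ← zero_add 2, ncard_dCol_two]
  have hrec : ∀ n : ℕ, 3 ≤ n →
      (d n : ℤ) = d (n - 1) + 2 * ∑ i ∈ Finset.range (n - 1), (catalan (i + 1) : ℤ) * d (n - i - 2)
        + 2 * catalan (n - 1) - 6 * catalan (n - 2) := by
    intro n hn
    obtain ⟨N, rfl⟩ : ∃ N, n = N + 3 := ⟨n - 3, by omega⟩
    have h := ncard_dCol_recurrence 0 N
    rw [show 0 + N + 3 = 0 + (N + 1) + 2 by omega, hcol 0 (N + 1),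
      show 0 + (N + 1) + 2 = 0 + 1 + N + 2 by omega, hcol (0 + 1) N] at h
    have hsum : ∑ k ∈ Finset.range N, catalan (k + 1) * (dCol (0 + k + 2) (0 + 1 + N + 2)).ncard =
        ∑ k ∈ Finset.range N, catalan (k + 1) * d (N + 3 - k - 2) := by
      refine Finset.sum_congr rfl fun k hk => ?_
      rw [Finset.mem_range] at hk
      rw [show 0 + 1 + N + 2 = 0 + k + 2 + (N - k - 1) + 2 by omega, hcol,
        show N - k - 1 + 2 = N + 3 - k - 2 by omega]
    rw [hsum] at h
    -- The sum in the statement has two more terms than the recurrence for colourings, those with d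
    -- 1 and d 0. They contribute 2 C (N+1) + 2 C (N+2), with C the Catalan numbers, which accounts
    -- for the change from 4, -4 to 2, -6.
    rw [show N + 3 - 1 = N + 2 by omega, show N + 3 - 2 = N + 1 by omega, Finset.sum_range_succ,
      Finset.sum_range_succ, show N + 3 - N - 2 = 1 by omega,
      show N + 3 - (N + 1) - 2 = 0 by omega, h0, h1]
    rw [show N + 1 + 2 = N + 3 by omega] at h
    zify at h
    push_cast
    linarith
  have c1 : catalan 1 = 1 := catalan_one
  have c2 : catalan 2 = 2 := catalan_two
  have c3 : catalan 3 = 5 := catalan_three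
  have c4 : catalan 4 = 14 := by
    rw [catalan_eq_centralBinom_div]
    decide
  have c5 : catalan 5 = 42 := by
    rw [catalan_eq_centralBinom_div]
    decide
  have h3 : d 3 = 5 := by
    have := hrec 3 (by norm_num)
    norm_num [Finset.sum_range_succ, h0, h1, h2, c1, c2] at this
    exact_mod_cast this
  have h4 : d 4 = 19 := by
    have := hrec 4 (by norm_num)
    norm_num [Finset.sum_range_succ, h0, h1, h2, h3, c1, c2, c3] at this
    exact_mod_cast this
  have h5 : d 5 = 69 := by
    have := hrec 5 (by norm_num)
    norm_num [Finset.sum_range_succ, h0, h1, h2, h3, h4, c1, c2, c3, c4] at this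
    exact_mod_cast this
  have h6 : d 6 = 249 := by
    have := hrec 6 (by norm_num)
    norm_num [Finset.sum_range_succ, h0, h1, h2, h3, h4, h5, c1, c2, c3, c4, c5] at this
    exact_mod_cast this
  exact ⟨⟨h0, h1, h2, h3, h4, h5, h6⟩, hrec⟩
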